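/- Let $q=p^h$ be a prime power and let $n\ge 2$ with $q=n+1$ or $q=n+2$, $(n,q)\neq(2,4)$. Let $H_\infty=\mathrm{PG}(n,q)$ be a hyperplane of $\mathrm{PG}(n+1,q)$, and let $\mathcal K\subset H_\infty$ be a $q$-arc of $H_\infty$, i.e. a set of $q$ points no $n+1$ of which lie in a hyperplane of $H_\infty$ (so $\mathcal K$ is a basis if $q=n+1$ and a frame if $q=n+2$). Let $\Gamma=\Gamma_{n,q}(\mathcal K)$ be the bipartite graph whose vertices are the points of $\mathrm{PG}(n+1,q)\setminus H_\infty$ and the lines of $\mathrm{PG}(n+1,q)$ that contain a point of $\mathcal K$ but do not lie in $H_\infty$, with adjacency given by incidence. Let $\mathrm{P\Gamma L}(n+2,q)_{\mathcal K}$ and $\mathrm{P\Gamma L}(n+1,q)_{\mathcal K}$ be the setwise stabilisers of $\mathcal K$ in the collineation groups of $\mathrm{PG}(n+1,q)$ and of $H_\infty$, and let $\mathrm{Persp}(H_\infty)$ be the group of all elements of $\mathrm{P\Gamma L}(n+2,q)$ that fix every point of $H_\infty$. Then: 1. $\Gamma$ is semisymmetric, i.e. regular and edge-transitive but not vertex-transitive.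 2. $\mathrm{P\Gamma L}(n+2,q)_{\mathcal K}$ acts faithfully on $\Gamma$, by its natural action on points and lines, and so is a subgroup of $\mathrm{Aut}(\Gamma)$. If $q=n+2$ and $q$ is prime, then it is all of $\mathrm{Aut}(\Gamma)$; in particular $\mathrm{Aut}(\Gamma)\cong\mathrm{P\Gamma L}(n+2,q)_{\mathcal K}$. 3. $\mathrm{P\Gamma L}(n+2,q)_{\mathcal K}\cong \mathrm{Persp}(H_\infty)\rtimes \mathrm{P\Gamma L}(n+1,q)_{\mathcal K}$; more precisely, $\mathrm{Persp}(H_\infty)$ is a normal subgroup of $\mathrm{P\Gamma L}(n+2,q)_{\mathcal K}$ with a complement that is mapped isomorphically onto $\mathrm{P\Gamma L}(n+1,q)_{\mathcal K}$ by restriction to $H_\infty$. 4. If $q=n+2$, then $\mathrm{P\Gamma L}(n+1,q)_{\mathcal K}\cong \mathrm{Sym}(q)\rtimes\mathrm{Aut}(\mathbb F_q)$, with $\mathrm{Aut}(\mathbb F_q)$ acting trivially on $\mathrm{Sym}(q)$, and $|\mathrm{P\Gamma L}(n+2,q)_{\mathcal K}|=h\,q^{n+1}(q-1)\,q!$. 5.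 If $q=n+1$, then $\mathrm{P\Gamma L}(n+1,q)_{\mathcal K}\cong \mathrm{PMon}(q)\rtimes\mathrm{Aut}(\mathbb F_q)$, where $\mathrm{PMon}(q)$ is the quotient of the group of monomial $q\times q$ matrices over $\mathbb F_q$ by the scalar matrices and $\mathrm{Aut}(\mathbb F_q)$ acts on matrix entries, and $|\mathrm{P\Gamma L}(n+2,q)_{\mathcal K}|=h\,q^{n+1}(q-1)^{n+1}\,q!$. -/

import Mathlib

open scoped LinearAlgebra.Projectivization Pointwise

namespace LinearRepresentation

/-! ### Projective spaces, arcs and collineations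

`PG(n,q)` is `ℙ F W` for a vector space `W` of dimension `n + 1` over the field `F` with `q`
elements; its subspaces are the members of `Projectivization.Subspace F W`. -/

/-- `K` is a `k`-arc in the `n`-dimensional projective space `ℙ F W`: a set of `k ≥ n + 1` points
such that no `n + 1` of them lie on a hyperplane. -/
def IsArc {F W : Type*} [Field F] [AddCommGroup W] [Module F W] (n k : ℕ) (K : Set (ℙ F W)) :
    Prop :=
  K.ncard = k ∧ n + 1 ≤ k ∧
    ∀ S : Set (ℙ F W), S ⊆ K → S.ncard = n + 1 →
      ∀ U : Submodule F W, Module.finrank F U = n →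
        ¬ S ⊆ (U.projectivization : Set (ℙ F W))

/-- The group `PΓL` of a projective space: the permutations of its points that are induced by
bijective semilinear maps of the underlying vector space. (When the vector space has dimension at
least `2`, a semilinear bijection fixes every point only if it is a scalar, so that this is the
quotient of the group of semilinear bijections by the scalars.) -/
def PGammaL (F W : Type*) [Field F] [AddCommGroup W] [Module F W] :
    Subgroup (Equiv.Perm (ℙ F W)) where
  carrier := {g | ∃ (σ : F ≃+* F) (f : W ≃+ W), (∀ (c : F) (w : W), f (c • w) = σ c • f w) ∧
    ∀ (w : W) (hw : w ≠ 0),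
      g (Projectivization.mk F w hw) =
        Projectivization.mk F (f w) ((map_ne_zero_iff f f.injective).mpr hw)}
  mul_mem' := by
    rintro a b ⟨σ, f, hf, ha⟩ ⟨τ, g, hg, hb⟩
    refine ⟨τ.trans σ, g.trans f, fun c w => by simp [hf, hg], fun w hw => ?_⟩
    rw [Equiv.Perm.mul_apply, hb, ha]
    rfl
  one_mem' := ⟨RingEquiv.refl F, AddEquiv.refl W, fun _ _ => rfl, fun _ _ => rfl⟩
  inv_mem' := by
    rintro a ⟨σ, f, hf, ha⟩
    refine ⟨σ.symm, f.symm, fun c w => f.injective (by simp [hf]), fun w hw => ?_⟩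
    rw [Equiv.Perm.inv_eq_iff_eq, ha]
    simp

/-- The setwise stabiliser of a point set `K` in `PΓL`. -/
abbrev PGammaLStab {F W : Type*} [Field F] [AddCommGroup W] [Module F W] (K : Set (ℙ F W)) :
    Subgroup (PGammaL F W) :=
  MulAction.stabilizer (PGammaL F W) K

/-- The inclusion of the points of the projective subspace of a submodule `H` into the points of
the ambient projective space. -/
def incl {F V : Type*} [Field F] [AddCommGroup V] [Module F V] (H : Submodule F V) :
    ℙ F H → ℙ F V :=
  Projectivization.map H.subtype H.injective_subtype

/-- The group `Persp(H)` of the elements of `PΓL` that fix all points of the hyperplane `H`. -/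
abbrev Persp {F V : Type*} [Field F] [AddCommGroup V] [Module F V] (H : Submodule F V) :
    Subgroup (PGammaL F V) :=
  fixingSubgroup (PGammaL F V) (H.projectivization : Set (ℙ F V))

/-! ### Linear representations and their incidence graphs -/

/-- The affine points: the points of the projective space that are not in the hyperplane `H`. -/
abbrev AffinePoint {F V : Type*} [Field F] [AddCommGroup V] [Module F V] (H : Submodule F V) :
    Type _ :=
  {P : ℙ F V // P ∉ H.projectivization}

/-- The lines of the linear representation of `K`: the lines of the ambient projective space that
contain a point of `K` and are not contained in the hyperplane `H`. -/
abbrev RepLine {F V : Type*} [Field F] [AddCommGroup V] [Module F V] (H : Submodule F V)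
    (K : Set (ℙ F H)) : Type _ :=
  {L : Projectivization.Subspace F V //
    Module.finrank F (Projectivization.Subspace.submodule L) = 2 ∧
    (∃ P ∈ K, incl H P ∈ L) ∧ ¬ L ≤ H.projectivization}

/-- The point-line incidence graph `Γ(K)` of the linear representation of `K`. -/
def incidenceGraph {F V : Type*} [Field F] [AddCommGroup V] [Module F V] (H : Submodule F V)
    (K : Set (ℙ F H)) : SimpleGraph (AffinePoint H ⊕ RepLine H K) where
  Adj
    | .inl P, .inr L => P.1 ∈ L.1
    | .inr L, .inl P => P.1 ∈ L.1
    | _, _ => False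
  symm := ⟨by rintro (P | L) (P' | L') h <;> exact h⟩
  loopless := ⟨by rintro (P | L) h <;> exact h⟩

/-- A graph is semisymmetric if it is regular and edge-transitive but not vertex-transitive. -/
def IsSemisymmetric {X : Type*} (G : SimpleGraph X) : Prop :=
  (∃ d : ℕ, ∀ x : X, (G.neighborSet x).encard = d) ∧
  (∀ e ∈ G.edgeSet, ∀ e' ∈ G.edgeSet, ∃ α : G ≃g G, Sym2.map α e = e') ∧
  ¬ ∀ x y : X, ∃ α : G ≃g G, α x = y

/-! ### Monomial matrices -/

/-- The group of monomial matrices: the invertible matrices with exactly one nonzero entry in each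
row and in each column. -/
def monomial (ι F : Type*) [Fintype ι] [DecidableEq ι] [Field F] : Subgroup (GL ι F) where
  carrier := {M | (∀ i, ∃! j, M i j ≠ 0) ∧ ∀ j, ∃! i, M i j ≠ 0}
  mul_mem' := by
    rintro A B ⟨hA, hA'⟩ ⟨hB, hB'⟩
    choose r hr hr' using hA
    choose s hs hs' using hB
    choose u hu hu' using hA'
    choose v hv hv' using hB'
    have h0 : ∀ i k, k ≠ r i → A i k = 0 := fun i k hk => by
      by_contra h
      exact hk (hr' i k h)
    have key : ∀ i j, (A * B) i j = A i (r i) * B (r i) j := fun i j => by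
      rw [Matrix.GeneralLinearGroup.coe_mul, Matrix.mul_apply]
      exact Finset.sum_eq_single _ (fun k _ hk => by rw [h0 i k hk, zero_mul]) (by simp)
    have hru : ∀ k, r (u k) = k := fun k => (hr' _ _ (hu k)).symm
    constructor
    · intro i
      refine ⟨s (r i), ?_, fun j hj => ?_⟩
      · simp only [key]
        exact mul_ne_zero (hr i) (hs _)
      · simp only [key] at hj
        exact hs' _ _ (right_ne_zero_of_mul hj)
    · intro j
      refine ⟨u (v j), ?_, fun i hi => ?_⟩
      · simp only [key, hru]
        exact mul_ne_zero (hu _) (hv _)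
      · simp only [key] at hi
        rw [← hv' _ _ (right_ne_zero_of_mul hi)]
        exact hu' _ _ (hr i)
  one_mem' := by
    have h : ∀ i j : ι, (1 : GL ι F) i j ≠ 0 ↔ i = j := fun i j => by
      simp [Matrix.one_apply]
    constructor
    · intro i
      exact ⟨i, (h _ _).mpr rfl, fun j hj => ((h _ _).mp hj).symm⟩
    · intro j
      exact ⟨j, (h _ _).mpr rfl, fun i hi => (h _ _).mp hi⟩
  inv_mem' := by
    rintro A ⟨hA, hA'⟩
    choose r hr hr' using hA
    choose u hu hu' using hA'
    have h0 : ∀ i k, k ≠ r i → A i k = 0 := fun i k hk => by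
      by_contra h
      exact hk (hr' i k h)
    have hru : ∀ k, r (u k) = k := fun k => (hr' _ _ (hu k)).symm
    have key : ∀ i j, A i (r i) * A⁻¹ (r i) j = (1 : GL ι F) i j := fun i j => by
      rw [← mul_inv_cancel A, Matrix.GeneralLinearGroup.coe_mul, Matrix.mul_apply]
      symm
      exact Finset.sum_eq_single _ (fun k _ hk => by rw [h0 i k hk, zero_mul]) (by simp)
    have h : ∀ k j, A⁻¹ k j ≠ 0 ↔ u k = j := fun k j => by
      have h1 := key (u k) j
      rw [hru] at h1
      have h2 : (1 : GL ι F) (u k) j ≠ 0 ↔ u k = j := by simp [Matrix.one_apply]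
      rw [← h2, ← h1]
      simp [hu k]
    constructor
    · intro k
      exact ⟨u k, (h _ _).mpr rfl, fun j hj => ((h _ _).mp hj).symm⟩
    · intro j
      refine ⟨r j, (h _ _).mpr (hu' _ _ (hr j)).symm, fun k hk => ?_⟩
      rw [← (h _ _).mp hk, hru]

/-- The scalar matrices, as a subgroup of the group of monomial matrices. -/
def monomialScalars (ι F : Type*) [Fintype ι] [DecidableEq ι] [Field F] :
    Subgroup (monomial ι F) :=
  (Matrix.GeneralLinearGroup.scalar ι (R := F)).range.subgroupOf (monomial ι F)

instance (ι F : Type*) [Fintype ι] [DecidableEq ι] [Field F] : (monomialScalars ι F).Normal := by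
  unfold monomialScalars
  rw [← Matrix.GeneralLinearGroup.center_eq_range_scalar]
  infer_instance

/-- `PMon`: the quotient of the group of monomial matrices by the scalar matrices. -/
abbrev PMon (ι F : Type*) [Fintype ι] [DecidableEq ι] [Field F] : Type _ :=
  monomial ι F ⧸ monomialScalars ι F

/-- A field automorphism, applied to the entries of monomial matrices. -/
def monomialMap (ι : Type*) {F : Type*} [Fintype ι] [DecidableEq ι] [Field F] (σ : RingAut F) :
    monomial ι F →* monomial ι F :=
  ((Matrix.GeneralLinearGroup.map (n := ι) (σ : F →+* F)).comp (monomial ι F).subtype).codRestrict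
    (monomial ι F) (by
      rintro ⟨M, hM, hM'⟩
      constructor
      · intro i
        simpa using hM i
      · intro j
        simpa using hM' j)

lemma monomialMap_scalars (ι : Type*) {F : Type*} [Fintype ι] [DecidableEq ι] [Field F]
    (σ : RingAut F) :
    monomialScalars ι F ≤ (monomialScalars ι F).comap (monomialMap ι σ) := by
  rintro ⟨M, hM⟩ ⟨c, hc⟩
  refine ⟨Units.map (σ : F →* F) c, ?_⟩
  change Matrix.GeneralLinearGroup.scalar ι c = M at hc
  subst hc
  exact (Matrix.GeneralLinearGroup.map_scalar (n := ι) (σ : F →+* F) c).symm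

/-- The action of `Aut(F)` on `PMon` that applies field automorphisms to the matrix entries. -/
def fieldAction (ι F : Type*) [Fintype ι] [DecidableEq ι] [Field F] :
    RingAut F →* MulAut (PMon ι F) where
  toFun σ :=
    { toFun := QuotientGroup.map _ _ (monomialMap ι σ) (monomialMap_scalars ι σ)
      invFun := QuotientGroup.map _ _ (monomialMap ι σ⁻¹) (monomialMap_scalars ι σ⁻¹)
      left_inv := by
        rintro ⟨M⟩
        refine congrArg (QuotientGroup.mk (s := monomialScalars ι F)) ?_
        ext i j
        exact σ.symm_apply_apply _
      right_inv := by
        rintro ⟨M⟩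
        refine congrArg (QuotientGroup.mk (s := monomialScalars ι F)) ?_
        ext i j
        exact σ.apply_symm_apply _
      map_mul' := map_mul _ }
  map_one' := by
    ext ⟨M⟩
    rfl
  map_mul' σ τ := by
    ext ⟨M⟩
    rfl

end LinearRepresentation

open LinearRepresentation

/-! Everything is read off from vectors `e i` of `H` that represent the points of `K`: a basis if `q
= n + 1`, and, if `q = n + 2`, vectors scaled so that `∑ e i = 0` is their only relation up to a
factor. Most arguments use only what the two cases share (`IsRepresentation`): the vectors span,
they satisfy no nontrivial relation with at most four terms, and semilinear bijections permute them
arbitrarily. For a frame every relation has constant coefficients, so the four-term condition needs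
`q > 4`; this is what excluding `(n, q) = (2, 4)` provides.

After identifying `V` with `F × H`, affine points are vectors of `H` and the lines are the cosets `w
+ F e i`. Both kinds of vertex have degree `q` because `|K| = |F|`, and translations together with
permutations of the `e i` move any edge to any other. Two lines through a point span parallelograms,
so every path of length four centred at a point closes to an octagon; for suitable paths centred at
a line, closing would produce a forbidden four-term relation. Hence no automorphism takes a point to
a line (`closesOctagons_point`, `not_closesOctagons_line`).

An automorphism therefore induces a map `A` on `H` that respects the cosets. By the four-term
condition, opposite sides of a parallelogram keep equal difference vectors, so the increment of `A`
along `e i` is unchanged by moves along the other `e j`. In a frame these span `H`, so `A` is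
additive up to a translation (`exists_additive`); over a prime field additive maps are linear, and
`A` comes from a collineation.

For the splitting, `a ^ q = a` makes lifts canonical: each collineation stabilising `K` has exactly
one lift whose coefficients on the `e i` have product `1`, and these lifts form a group
(`exists_section`). Extending them to `V` gives the complement of `Persp H`. The orders follow by
counting the perspectivities and the monomial maps modulo scalars. -/

namespace LinearRepresentation

/-! ### Semilinear automorphisms -/

/-- The bijective semilinear self-maps of a vector space. -/
structure GammaL (F W : Type*) [Field F] [AddCommGroup W] [Module F W] where
  /-- the field automorphism -/
  σ : F ≃+* F
  /-- the additive bijection -/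
  f : W ≃+ W
  map_smul' : ∀ (c : F) (w : W), f (c • w) = σ c • f w

namespace GammaL

section Basic

variable {F W : Type*} [Field F] [AddCommGroup W] [Module F W]

instance : CoeFun (GammaL F W) (fun _ => W → W) := ⟨fun x => x.f⟩

lemma apply_smul (x : GammaL F W) (c : F) (w : W) : x (c • w) = x.σ c • x w := x.map_smul' c w

lemma ext' {x y : GammaL F W} (h : x.σ = y.σ) (h' : ∀ w, x w = y w) : x = y := by
  cases x; cases y
  obtain rfl := h
  congr
  exact AddEquiv.ext h'

instance : Group (GammaL F W) where
  mul x y := ⟨y.σ.trans x.σ, y.f.trans x.f, fun c w => by simp [apply_smul]⟩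
  one := ⟨RingEquiv.refl F, AddEquiv.refl W, fun _ _ => rfl⟩
  inv x := ⟨x.σ.symm, x.f.symm, fun c w => x.f.injective (by simp [apply_smul])⟩
  mul_assoc _ _ _ := rfl
  one_mul _ := rfl
  mul_one _ := rfl
  inv_mul_cancel x := ext' (RingEquiv.ext fun c => x.σ.symm_apply_apply c)
    fun w => x.f.symm_apply_apply w

@[simp] lemma mul_apply (x y : GammaL F W) (w : W) : (x * y) w = x (y w) := rfl
@[simp] lemma one_apply (w : W) : (1 : GammaL F W) w = w := rfl
@[simp] lemma mul_σ (x y : GammaL F W) : (x * y).σ = x.σ * y.σ := rfl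
@[simp] lemma inv_apply_apply (x : GammaL F W) (w : W) : x⁻¹ (x w) = w :=
  x.f.symm_apply_apply w
@[simp] lemma apply_inv_apply (x : GammaL F W) (w : W) : x (x⁻¹ w) = w :=
  x.f.apply_symm_apply w

lemma ne_zero (x : GammaL F W) {w : W} (hw : w ≠ 0) : x w ≠ 0 :=
  (map_ne_zero_iff x.f x.f.injective).mpr hw

/-- The permutation of the points of the projective space that a semilinear bijection induces. -/
def toFun (x : GammaL F W) : ℙ F W → ℙ F W :=
  Projectivization.map (σ := (x.σ : F →+* F))
    { toFun := x.f, map_add' := map_add x.f, map_smul' := x.map_smul' } x.f.injective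

lemma toFun_mk (x : GammaL F W) (w : W) (hw : w ≠ 0) :
    x.toFun (Projectivization.mk F w hw) = Projectivization.mk F (x w) (x.ne_zero hw) := rfl

/-- The collineation that a semilinear bijection induces. -/
def toPGammaL : GammaL F W →* PGammaL F W where
  toFun x := ⟨⟨x.toFun, x⁻¹.toFun,
    fun P => by induction P using Projectivization.ind with | h w hw => simp [toFun_mk],
    fun P => by induction P using Projectivization.ind with | h w hw => simp [toFun_mk]⟩,
    x.σ, x.f, x.map_smul', fun _ _ => rfl⟩
  map_one' := by
    ext P
    induction P using Projectivization.ind with | h w hw => rfl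
  map_mul' x y := by
    ext P
    induction P using Projectivization.ind with | h w hw => rfl

@[simp] lemma toPGammaL_smul_mk (x : GammaL F W) (w : W) (hw : w ≠ 0) :
    toPGammaL x • Projectivization.mk F w hw = Projectivization.mk F (x w) (x.ne_zero hw) := rfl

lemma toPGammaL_surjective : Function.Surjective (toPGammaL (F := F) (W := W)) := by
  rintro ⟨g, σ, f, hf, hg⟩
  refine ⟨⟨σ, f, hf⟩, ?_⟩
  ext P
  induction P using Projectivization.ind with | h w hw => exact (hg w hw).symm

/-- The homotheties. -/
def scalar (a : Fˣ) : GammaL F W where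
  σ := 1
  f := DistribMulAction.toAddEquiv W a
  map_smul' _ _ := smul_comm _ _ _

@[simp] lemma scalar_apply (a : Fˣ) (w : W) : (scalar a : GammaL F W) w = (a : F) • w := rfl
@[simp] lemma scalar_σ (a : Fˣ) : (scalar a : GammaL F W).σ = 1 := rfl

@[simp] lemma toPGammaL_scalar (a : Fˣ) : toPGammaL (scalar a : GammaL F W) = 1 := by
  ext P
  induction P using Projectivization.ind with | h w hw =>
  exact (Projectivization.mk_eq_mk_iff' F _ _ _ _).mpr ⟨a, rfl⟩

/-- Comparing `x u`, `x v` and `x (u + v)` shows that independent vectors have equal eigenvalues;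
two dependent vectors are compared through a third vector independent of both. Once `x` is a
homothety, semilinearity forces its field automorphism to be trivial. -/
lemma eq_scalar_of_eigen (hW : 2 ≤ Module.finrank F W) (x : GammaL F W)
    (h : ∀ w : W, ∃ c : F, c • w = x w) : ∃ a : Fˣ, x = scalar a := by
  have key : ∀ (u v : W) (b c : F), LinearIndependent F ![u, v] → b • u = x u → c • v = x v →
      b = c := by
    intro u v b c hi hb hc
    obtain ⟨d, hd⟩ := h (u + v)
    have e : (d - b) • u + (d - c) • v = 0 := by
      have : x (u + v) = x u + x v := map_add x.f u v
      rw [this, ← hb, ← hc] at hd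
      rw [sub_smul, sub_smul, sub_add_sub_comm, ← smul_add, hd, sub_self]
    obtain ⟨h1, h2⟩ := LinearIndependent.pair_iff.mp hi _ _ e
    rw [← sub_eq_zero.mp h1, ← sub_eq_zero.mp h2]
  have : Nontrivial W := Module.nontrivial_of_finrank_pos (R := F) (by lia)
  obtain ⟨u, hu⟩ := exists_ne (0 : W)
  obtain ⟨a, ha⟩ := h u
  have ha0 : a ≠ 0 := by
    rintro rfl
    exact x.ne_zero hu (by rw [← ha, zero_smul])
  have other : ∀ w : W, w ≠ 0 → ∃ v, LinearIndependent F ![w, v] := fun w hw =>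
    exists_linearIndependent_pair_of_one_lt_finrank (by lia) hw
  have all : ∀ w, x w = a • w := by
    intro w
    rcases eq_or_ne w 0 with rfl | hw
    · rw [smul_zero]; exact map_zero x.f
    obtain ⟨v, hv⟩ := other u hu
    obtain ⟨b, hb⟩ := h w
    obtain ⟨c, hc⟩ := h v
    by_cases hi : LinearIndependent F ![u, w]
    · rw [key u w a b hi ha hb, hb]
    · have hac := key u v a c hv ha hc
      rw [LinearIndependent.pair_iff' hu] at hi
      push Not at hi
      obtain ⟨d, rfl⟩ := hi
      have hd : d ≠ 0 := by rintro rfl; simp at hw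
      have : LinearIndependent F ![d • u, v] := by
        rw [LinearIndependent.pair_iff] at hv ⊢
        intro s t hst
        rw [smul_smul] at hst
        obtain ⟨h1, h2⟩ := hv _ _ hst
        exact ⟨(mul_eq_zero.mp h1).resolve_right hd, h2⟩
      rw [hac, ← key _ _ b c this hb hc, hb]
  refine ⟨Units.mk0 a ha0, ext' (RingEquiv.ext fun c => ?_) fun w => by simp [all]⟩
  have h1 := x.apply_smul c u
  rw [all, all, smul_smul, smul_smul] at h1
  have h2 := smul_left_injective F hu h1
  simp only [scalar_σ, RingAut.one_apply]
  exact mul_left_cancel₀ ha0 (by rw [h2, mul_comm])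

lemma eigen_of_toPGammaL_smul {x : GammaL F W} {w : W} (hw : w ≠ 0)
    (h : toPGammaL x • Projectivization.mk F w hw = Projectivization.mk F w hw) :
    ∃ c : F, c • w = x w := by
  rw [toPGammaL_smul_mk, Projectivization.mk_eq_mk_iff'] at h
  exact h

lemma eq_scalar_of_toPGammaL_eq_one (hW : 2 ≤ Module.finrank F W) {x : GammaL F W}
    (h : toPGammaL x = 1) : ∃ a : Fˣ, x = scalar a := by
  refine eq_scalar_of_eigen hW x fun w => ?_
  rcases eq_or_ne w 0 with rfl | hw
  · exact ⟨0, by rw [zero_smul]; exact (map_zero x.f).symm⟩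
  · exact eigen_of_toPGammaL_smul hw (by rw [h, one_smul])

lemma eq_scalar_mul_of_toPGammaL_eq (hW : 2 ≤ Module.finrank F W) {x y : GammaL F W}
    (h : toPGammaL x = toPGammaL y) : ∃ a : Fˣ, x = scalar a * y := by
  obtain ⟨a, ha⟩ := eq_scalar_of_toPGammaL_eq_one hW (x := x * y⁻¹)
    (by rw [map_mul, h, map_inv, mul_inv_cancel])
  exact ⟨a, by rw [← ha, inv_mul_cancel_right]⟩

lemma apply_sum_smul {ι : Type*} (s : Finset ι) (x : GammaL F W) (c : ι → F) (w : ι → W) :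
    x (∑ i ∈ s, c i • w i) = ∑ i ∈ s, x.σ (c i) • x (w i) := by
  rw [map_sum x.f]
  exact Finset.sum_congr rfl fun i _ => x.apply_smul _ _

lemma ext_of_span {ι : Type*} {e : ι → W} (he : Submodule.span F (Set.range e) = ⊤)
    {x y : GammaL F W} (h : x.σ = y.σ) (h' : ∀ i, x (e i) = y (e i)) : x = y := by
  refine ext' h fun w => ?_
  have hw : w ∈ Submodule.span F (Set.range e) := by rw [he]; trivial
  induction hw using Submodule.span_induction with
  | mem w hw => obtain ⟨i, rfl⟩ := hw; exact h' i
  | zero => exact (map_zero x.f).trans (map_zero y.f).symm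
  | add v w _ _ hv hw =>
    exact (map_add x.f v w).trans ((congrArg₂ _ hv hw).trans (map_add y.f v w).symm)
  | smul c w _ hw => rw [apply_smul, apply_smul, h, hw]

/-- The semilinear bijection that maps one basis to another. -/
noncomputable def ofBasis {ι : Type*} [Fintype ι] (b b' : Module.Basis ι F W) (σ : F ≃+* F) :
    GammaL F W where
  σ := σ
  f := (b.equivFun.toAddEquiv.trans (AddEquiv.piCongrRight fun _ => σ.toAddEquiv)).trans
    b'.equivFun.symm.toAddEquiv
  map_smul' c w := by
    simp [Module.Basis.equivFun_symm_apply, Finset.smul_sum, smul_smul]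

lemma ofBasis_apply {ι : Type*} [Fintype ι] (b b' : Module.Basis ι F W) (σ : F ≃+* F) (i : ι) :
    ofBasis b b' σ (b i) = b' i := by
  classical
  simp [ofBasis, Module.Basis.equivFun_symm_apply, Finsupp.single_apply]

end Basic

end GammaL

/-! ### Representatives of the points of an arc -/

section Arc

variable {F W : Type*} [Field F] [AddCommGroup W] [Module F W]

/-- Vectors `e i` that represent the points of `K`, span the space, satisfy no nontrivial relation
with at most four terms, and can be permuted arbitrarily by semilinear bijections. -/
structure IsRepresentation {ι : Type*} [Fintype ι] [DecidableEq ι] (K : Set (ℙ F W))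
    (e : ι → W) : Prop where
  ne_zero : ∀ i, e i ≠ 0
  mem_iff : ∀ P, P ∈ K ↔ ∃ i, P = Projectivization.mk F (e i) (ne_zero i)
  span_eq : Submodule.span F (Set.range e) = ⊤
  relation : ∀ (a b c d : ι) (x y z u : F), x • e a + y • e b + z • e c + u • e d = 0 →
    (Pi.single a x + Pi.single b y + Pi.single c z + Pi.single d u : ι → F) = 0
  permute : ∀ (σ : F ≃+* F) (π : Equiv.Perm ι), ∃ x : GammaL F W, x.σ = σ ∧
    ∀ i, x (e i) = e (π i)

lemma sum_single_smul {ι : Type*} [Fintype ι] [DecidableEq ι] (e : ι → W) (a b c d : ι)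
    (x y z u : F) :
    ∑ i, (Pi.single a x + Pi.single b y + Pi.single c z + Pi.single d u : ι → F) i • e i =
      x • e a + y • e b + z • e c + u • e d := by
  simp only [Pi.add_apply, add_smul, Finset.sum_add_distrib]
  have h : ∀ (a : ι) (x : F), ∑ i, (Pi.single a x : ι → F) i • e i = x • e a := fun a x => by
    rw [Finset.sum_eq_single a (fun i _ hi => by rw [Pi.single_eq_of_ne hi, zero_smul])
      (by simp), Pi.single_eq_same]
  rw [h, h, h, h]

/-- If `n + 1` of the vectors were dependent, their span would be proper and hence lie in the kernel
of a nonzero functional, a hyperplane with `n + 1` points of the arc. -/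
lemma IsArc.exists_vectors {n q : ℕ} (hW : Module.finrank F W = n + 1) {K : Set (ℙ F W)}
    (hK : IsArc n q K) :
    ∃ (e : Fin q → W) (h0 : ∀ i, e i ≠ 0),
      (∀ P, P ∈ K ↔ ∃ i, P = Projectivization.mk F (e i) (h0 i)) ∧
      ∀ S : Finset (Fin q), S.card = n + 1 → LinearIndepOn F e S := by
  have : Module.Finite F W := Module.finite_of_finrank_pos (by lia)
  obtain ⟨hc, hnq, hK⟩ := hK
  have : Finite K := Set.finite_of_ncard_pos (by lia)
  have hc' : Nat.card K = q := hc
  let k : Fin q ≃ K := (Finite.equivFinOfCardEq hc').symm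
  refine ⟨fun i => (k i).1.rep, fun i => (k i).1.rep_nonzero, fun P => ?_, fun S hS => ?_⟩
  · simp only [Projectivization.mk_rep]
    exact ⟨fun h => ⟨k.symm ⟨P, h⟩, by simp⟩, by rintro ⟨i, rfl⟩; exact (k i).2⟩
  by_contra hli
  set U := Submodule.span F (Set.range fun i : S => (k i).1.rep)
  have hU : U < ⊤ := by
    rw [lt_top_iff_ne_top]
    intro hU
    apply hli
    apply linearIndependent_of_top_le_span_of_card_eq_finrank (ι := S)
    · exact hU.ge
    · simp [hS, hW]
  obtain ⟨φ, hφ, hle⟩ := Submodule.exists_le_ker_of_lt_top U hU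
  refine hK ((fun i => (k i).1) '' S) ?_ ?_ (LinearMap.ker φ) ?_ ?_
  · rintro _ ⟨i, _, rfl⟩
    exact (k i).2
  · rw [Set.ncard_image_of_injective _ (fun i j h => k.injective (Subtype.ext h)),
      Set.ncard_coe_finset, hS]
  · have := Module.Dual.finrank_ker_add_one_of_ne_zero (K := F) hφ
    lia
  · rintro _ ⟨i, hi, rfl⟩
    change (k i).1 ∈ (LinearMap.ker φ).projectivization
    rw [← (k i).1.mk_rep, Submodule.mk_mem_projectivization_iff]
    exact hle (Submodule.subset_span ⟨⟨i, hi⟩, rfl⟩)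

/-- An arc of `n + 1` points is represented by a basis. -/
lemma IsArc.exists_basis {n q : ℕ} (hW : Module.finrank F W = n + 1) (hq : q = n + 1)
    {K : Set (ℙ F W)} (hK : IsArc n q K) :
    ∃ b : Module.Basis (Fin q) F W, IsRepresentation K b := by
  obtain ⟨e, h0, hmem, hli⟩ := hK.exists_vectors hW
  have hind : LinearIndependent F e := by
    have := hli Finset.univ (by simp [hq])
    rwa [Finset.coe_univ, linearIndepOn_univ_iff] at this
  have : Nonempty (Fin q) := ⟨⟨0, by lia⟩⟩
  let b := basisOfLinearIndependentOfCardEqFinrank hind (by simp [hq, hW])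
  have hb : ⇑b = e := coe_basisOfLinearIndependentOfCardEqFinrank _ _
  refine ⟨b, fun i => hb ▸ h0 i, by simpa only [hb] using hmem, b.span_eq, ?_, ?_⟩
  · intro i j k l x y z u h
    rw [← sum_single_smul] at h
    funext m
    exact Fintype.linearIndependent_iff.mp b.linearIndependent _ h m
  · intro σ π
    refine ⟨GammaL.ofBasis b (b.reindex π.symm) σ, rfl, fun i => ?_⟩
    simp [GammaL.ofBasis_apply]

/-- An arc of `n + 2` points is a frame. -/
lemma IsArc.exists_frame {n q : ℕ} (hW : Module.finrank F W = n + 1) (hq : q = n + 2)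
    (hq4 : 4 < q) {K : Set (ℙ F W)} (hK : IsArc n q K) :
    ∃ e : Fin q → W, IsRepresentation K e ∧ ∑ i, e i = 0 ∧
      (∀ c : Fin q → F, ∑ i, c i • e i = 0 → ∀ i j, c i = c j) ∧
      ∀ j, Submodule.span F (Set.range fun i : {i // i ≠ j} => e i.1) = ⊤ := by
  have : Module.Finite F W := Module.finite_of_finrank_pos (by lia)
  obtain ⟨e', h0', hmem', hli⟩ := hK.exists_vectors hW
  -- A relation with one vanishing coefficient involves at most `q - 1 = n + 1` vectors, which are
  -- independent.
  have hrel' : ∀ (c : Fin q → F) (j : Fin q), ∑ i, c i • e' i = 0 → c j = 0 → c = 0 := by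
    intro c j hc hj
    have h1 := linearIndepOn_finset_iff.mp (hli (Finset.univ.erase j) (by simp [hq])) c (by
      rw [← hc]
      refine Finset.sum_subset (Finset.subset_univ _) fun i _ hi => ?_
      obtain rfl : i = j := by simpa using hi
      rw [hj, zero_smul])
    funext i
    by_cases hi : i = j
    · rw [hi, hj]; rfl
    · exact h1 i (by simpa using hi)
  obtain ⟨g, hg, i₀, hi₀⟩ : ∃ g : Fin q → F, ∑ i, g i • e' i = 0 ∧ ∃ i, g i ≠ 0 := by
    apply Fintype.not_linearIndependent_iff.mp
    intro h
    have := h.fintype_card_le_finrank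
    simp [hq, hW] at this
  have hg0 : ∀ i, g i ≠ 0 := fun j hj => hi₀ (congrFun (hrel' g j hg hj) i₀)
  obtain ⟨e, he⟩ : ∃ e : Fin q → W, ∀ i, e i = g i • e' i := ⟨_, fun _ => rfl⟩
  have h0 : ∀ i, e i ≠ 0 := fun i => by rw [he]; exact smul_ne_zero (hg0 i) (h0' i)
  have hsum : ∑ i, e i = 0 := by simpa only [he] using hg
  have hrel : ∀ c : Fin q → F, ∑ i, c i • e i = 0 → ∀ i j, c i = c j := by
    intro c hc i j
    -- Subtract `c j` times `∑ e i = 0`: expressed in the `e' i`, the difference is a relation whose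
    -- `j`-th coefficient vanishes.
    have h := hrel' (fun i => (c i - c j) * g i) j (by
      simp only [← smul_smul, ← he, sub_smul, Finset.sum_sub_distrib, hc, ← Finset.smul_sum,
        hsum, smul_zero, sub_zero]) (by simp)
    exact sub_eq_zero.mp ((mul_eq_zero.mp (congrFun h i)).resolve_right (hg0 i))
  have hind : ∀ (π : Equiv.Perm (Fin q)) (j : Fin q),
      LinearIndependent F fun i : {i // i ≠ j} => e (π i.1) := by
    intro π j
    have h1 : LinearIndepOn F e (Finset.univ.erase (π j) : Finset (Fin q)) := by
      rw [linearIndepOn_finset_iff]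
      intro c hc i hi
      let c' : Fin q → F := Function.update c (π j) 0
      have hc' : ∀ i, i ≠ π j → c' i = c i := fun i hi => Function.update_of_ne hi _ _
      have hc0 : c' (π j) = 0 := Function.update_self _ _ _
      rw [← hc' i (by simpa using hi), hrel c' ?_ i (π j), hc0]
      rw [← Finset.sum_erase_add _ _ (Finset.mem_univ (π j)), hc0, zero_smul,
        add_zero, ← hc]
      exact Finset.sum_congr rfl fun i hi => by rw [hc' i (by simpa using hi)]
    exact LinearIndependent.comp h1
      (fun i : {i // i ≠ j} => ⟨π i.1, by simp [i.2]⟩)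
      (fun i i' h => Subtype.ext (π.injective (by simpa using h)))
  have hspan : ∀ j, Submodule.span F (Set.range fun i : {i // i ≠ j} => e i.1) = ⊤ := fun j =>
    (hind 1 j).span_eq_top_of_card_eq_finrank' (by simp [hq, hW])
  refine ⟨e, ⟨h0, fun P => ?_, ?_, ?_, ?_⟩, hsum, hrel, hspan⟩
  · rw [hmem']
    refine exists_congr fun i => ?_
    suffices h : Projectivization.mk F (e' i) (h0' i) = Projectivization.mk F (e i) (h0 i) by
      rw [h]
    exact ((Projectivization.mk_eq_mk_iff' F _ _ _ _).mpr ⟨g i, (he i).symm⟩).symm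
  · rw [eq_top_iff, ← hspan i₀]
    exact Submodule.span_mono (by rintro _ ⟨i, rfl⟩; exact ⟨i, rfl⟩)
  · intro i j k l x y z u h
    rw [← sum_single_smul] at h
    -- Since `q > 4`, some index `m` is not involved. Its coefficient is `0`, and all coefficients
    -- of a relation are equal.
    obtain ⟨m, hm⟩ : ∃ m, m ∉ ({i, j, k, l} : Finset (Fin q)) := by
      by_contra! hall
      have h1 : (Finset.univ : Finset (Fin q)).card ≤ ({i, j, k, l} : Finset (Fin q)).card :=
        Finset.card_le_card fun m _ => hall m
      have := Finset.card_le_four (a := i) (b := j) (c := k) (d := l)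
      simp at h1
      lia
    simp only [Finset.mem_insert, Finset.mem_singleton, not_or] at hm
    funext m'
    rw [hrel _ h m' m]
    simp [Pi.single_eq_of_ne, hm]
  · intro σ π
    let b := basisOfLinearIndependentOfCardEqFinrank' _ (hind 1 i₀) (by simp [hq, hW])
    let b' := basisOfLinearIndependentOfCardEqFinrank' _ (hind π i₀) (by simp [hq, hW])
    have hx : ∀ i, i ≠ i₀ → GammaL.ofBasis b b' σ (e i) = e (π i) := by
      intro i hi
      have := GammaL.ofBasis_apply b b' σ ⟨i, hi⟩
      simpa [b, b'] using this
    refine ⟨GammaL.ofBasis b b' σ, rfl, fun i => ?_⟩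
    by_cases hi : i = i₀
    · subst hi
      -- The image of the omitted vector is forced: the differences sum to zero, and all the others
      -- vanish.
      have h1 : ∑ k, (GammaL.ofBasis b b' σ (e k) - e (π k)) = 0 := by
        rw [Finset.sum_sub_distrib, Equiv.sum_comp π e, hsum,
          ← map_sum (GammaL.ofBasis b b' σ).f, hsum, map_zero, sub_zero]
      rw [Finset.sum_eq_single i (fun k _ hk => by rw [hx k hk, sub_self]) (by simp)] at h1
      exact sub_eq_zero.mp h1
    · exact hx i hi

end Arc

/-! ### Lifting the stabiliser of an arc to semilinear bijections -/

section Section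

variable {F W ι : Type*} [Field F] [AddCommGroup W] [Module F W] [Fintype ι] [DecidableEq ι]
  {K : Set (ℙ F W)} {e : ι → W}

namespace IsRepresentation

lemma smul_eq_smul (he : IsRepresentation K e) {i j : ι} {a b : F} (ha : a ≠ 0)
    (h : a • e i = b • e j) : i = j ∧ a = b := by
  have h1 := he.relation i j i i a (-b) 0 0 (by rw [h]; simp)
  have h2 := congrFun h1 i
  by_cases hij : i = j
  · subst hij
    refine ⟨rfl, ?_⟩
    simpa [← sub_eq_add_neg, sub_eq_zero] using h2
  · simp [hij, ha] at h2

lemma mem (he : IsRepresentation K e) (i : ι) : Projectivization.mk F (e i) (he.ne_zero i) ∈ K :=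
  (he.mem_iff _).mpr ⟨i, rfl⟩

lemma mem_stabilizer_iff (he : IsRepresentation K e) (x : GammaL F W) :
    GammaL.toPGammaL x ∈ PGammaLStab K ↔
      ∃ (c : ι → Fˣ) (π : Equiv.Perm ι), ∀ i, x (e i) = (c i : F) • e (π i) := by
  constructor
  · intro hx
    have h1 : ∀ i, ∃ (c : Fˣ) (j : ι), x (e i) = (c : F) • e j := by
      intro i
      have h2 : GammaL.toPGammaL x • Projectivization.mk F (e i) (he.ne_zero i) ∈ K :=
        (MulAction.mem_stabilizer_iff.mp hx).subset (Set.smul_mem_smul_set (he.mem i))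
      obtain ⟨j, hj⟩ := (he.mem_iff _).mp h2
      rw [GammaL.toPGammaL_smul_mk, Projectivization.mk_eq_mk_iff] at hj
      obtain ⟨c, hc⟩ := hj
      exact ⟨c, j, hc.symm⟩
    choose c π hc using h1
    have hπ : Function.Injective π := by
      intro i j hij
      -- If `e i` and `e j` had proportional images, suitable multiples of them would have the same
      -- image; the factors are pulled back through `x.σ`.
      have h4 : x (x.σ.symm (c j : F) • e i) = x (x.σ.symm (c i : F) • e j) := by
        rw [x.apply_smul, x.apply_smul, hc, hc, hij]
        simp only [RingEquiv.apply_symm_apply]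
        exact smul_comm _ _ _
      exact (he.smul_eq_smul (by simp) (x.f.injective h4)).1
    exact ⟨c, Equiv.ofBijective π (Finite.injective_iff_bijective.mp hπ), hc⟩
  · rintro ⟨c, π, hc⟩
    have hk : ∀ i, GammaL.toPGammaL x • Projectivization.mk F (e i) (he.ne_zero i) =
        Projectivization.mk F (e (π i)) (he.ne_zero _) := fun i => by
      rw [GammaL.toPGammaL_smul_mk, Projectivization.mk_eq_mk_iff]
      exact ⟨c i, (hc i).symm⟩
    rw [MulAction.mem_stabilizer_iff]
    ext P
    rw [Set.mem_smul_set]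
    constructor
    · rintro ⟨Q, hQ, rfl⟩
      obtain ⟨i, rfl⟩ := (he.mem_iff _).mp hQ
      rw [hk]
      exact he.mem _
    · intro hP
      obtain ⟨i, rfl⟩ := (he.mem_iff _).mp hP
      exact ⟨_, he.mem (π.symm i), by simp [hk]⟩

/-- If an arc has as many points as the field has elements, then its collineation stabiliser lifts
to a group of semilinear bijections: every collineation has a unique lift that maps the
representatives `e i` to `c i • e (π i)` with `∏ c i = 1`. -/
lemma exists_section [Finite F] (he : IsRepresentation K e) (hW : 2 ≤ Module.finrank F W)
    (hι : Fintype.card ι = Nat.card F) :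
    ∃ s : PGammaLStab K →* GammaL F W, ∀ g, GammaL.toPGammaL (s g) = g := by
  have : Fintype F := Fintype.ofFinite F
  -- The index set has `q` elements, so scaling a lift by `a` multiplies the product of its
  -- coefficients by `a ^ q = a`. Hence exactly one scalar multiple has product `1`.
  have hpow : ∀ a : Fˣ, a ^ Fintype.card ι = a := fun a => by
    rw [hι, Nat.card_eq_fintype_card]
    exact Units.ext (by simp [FiniteField.pow_card])
  let N : GammaL F W → Prop := fun x => ∃ (c : ι → Fˣ) (π : Equiv.Perm ι),
    (∀ i, x (e i) = (c i : F) • e (π i)) ∧ ∏ i, c i = 1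
  have hex : ∀ g : PGammaLStab K, ∃ x : GammaL F W, GammaL.toPGammaL x = g ∧ N x := by
    rintro ⟨g, hg⟩
    obtain ⟨x, rfl⟩ := GammaL.toPGammaL_surjective g
    obtain ⟨c, π, hc⟩ := (he.mem_stabilizer_iff x).mp hg
    refine ⟨GammaL.scalar (∏ i, c i)⁻¹ * x, by simp, fun i => (∏ i, c i)⁻¹ * c i, π,
      fun i => ?_, ?_⟩
    · rw [GammaL.mul_apply, GammaL.scalar_apply, hc, smul_smul, Units.val_mul]
    · rw [Finset.prod_mul_distrib, Finset.prod_const, Finset.card_univ, hpow, inv_mul_cancel]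
  have huniq : ∀ x y, GammaL.toPGammaL x = GammaL.toPGammaL y → N x → N y → x = y := by
    rintro x y hxy ⟨c, π, hc, hc1⟩ ⟨d, ρ, hd, hd1⟩
    obtain ⟨a, rfl⟩ := GammaL.eq_scalar_mul_of_toPGammaL_eq hW hxy
    have h1 : ∀ i, c i = a * d i := fun i => Units.ext (by
      have := hc i
      rw [GammaL.mul_apply, GammaL.scalar_apply, hd, smul_smul] at this
      rw [← (he.smul_eq_smul (mul_ne_zero a.ne_zero (d i).ne_zero) this).2, Units.val_mul])
    simp only [h1, Finset.prod_mul_distrib, Finset.prod_const, Finset.card_univ, hpow, hd1,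
      mul_one] at hc1
    rw [hc1]
    exact GammaL.ext' rfl fun w => by simp
  have hmul : ∀ x y, N x → N y → N (x * y) := by
    rintro x y ⟨c, π, hc, hc1⟩ ⟨d, ρ, hd, hd1⟩
    -- The coefficients of `x * y` are those of `y` twisted by `x.σ`, times a permutation of those
    -- of `x`; neither the twist nor the permutation disturbs the product `1`.
    refine ⟨fun i => Units.map (x.σ : F →* F) (d i) * c (ρ i), π * ρ, fun i => ?_, ?_⟩
    · rw [GammaL.mul_apply, hd, x.apply_smul, hc, smul_smul]
      rfl
    · rw [Finset.prod_mul_distrib, Equiv.prod_comp ρ c, hc1, ← map_prod, hd1, map_one, mul_one]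
  choose s hs hN using hex
  exact ⟨MonoidHom.mk' s fun g h => huniq _ _ (by simp [hs]) (hN _) (hmul _ _ (hN g) (hN h)), hs⟩

end IsRepresentation

end Section

/-! ### The collineations that stabilise a hyperplane -/

section Hyperplane

variable {F V : Type*} [Field F] [AddCommGroup V] [Module F V] {H : Submodule F V}

lemma incl_injective : Function.Injective (incl H) :=
  Projectivization.map_injective _ H.injective_subtype

lemma mem_projectivization_iff {P : ℙ F V} : P ∈ H.projectivization ↔ ∃ Q, incl H Q = P := by
  constructor
  · induction P using Projectivization.ind with | h v hv =>
    intro h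
    exact ⟨Projectivization.mk F (⟨v, h⟩ : H) (fun h0 => hv (congrArg Subtype.val h0)), rfl⟩
  · rintro ⟨Q, rfl⟩
    induction Q using Projectivization.ind with | h w hw => exact w.2

/-- A splitting of the ambient space of a hyperplane. -/
lemma exists_splitting [Module.Finite F V]
    (hH : Module.finrank F V = Module.finrank F H + 1) :
    ∃ Θ : (F × H) ≃ₗ[F] V, ∀ w, Θ (0, w) = w := by
  obtain ⟨v, hv⟩ : ∃ v, v ∉ H := by
    by_contra! h
    rw [(Submodule.eq_top_iff').mpr h, finrank_top] at hH
    lia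
  let T : F × H →ₗ[F] V := (LinearMap.toSpanSingleton F V v).coprod H.subtype
  have hT : Function.Injective T := by
    rw [← LinearMap.ker_eq_bot, LinearMap.ker_eq_bot']
    rintro ⟨a, w⟩ h
    have h1 : a • v + (w : V) = 0 := h
    have ha : a = 0 := by
      by_contra ha
      apply hv
      rw [← H.smul_mem_iff ha, eq_neg_of_add_eq_zero_left h1]
      exact H.neg_mem w.2
    subst ha
    simpa using h1
  refine ⟨LinearMap.linearEquivOfInjective T hT ?_, fun w => ?_⟩
  · rw [Module.finrank_prod, Module.finrank_self, hH, add_comm]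
  · simp [T]

namespace GammaL

/-- The extension of a semilinear bijection `x` of a hyperplane to the whole space, with
translation vector `t`. -/
def affine (Θ : (F × H) ≃ₗ[F] V) (t : H) (x : GammaL F H) : GammaL F V where
  σ := x.σ
  f := (Θ.symm.toAddEquiv.trans
    { toFun := fun a => (x.σ a.1, x.σ a.1 • t + x a.2)
      invFun := fun a => (x.σ.symm a.1, x⁻¹ (a.2 - a.1 • t))
      left_inv := fun a => by simp
      right_inv := fun a => by simp
      map_add' := fun a b => by
        ext
        · simp
        · simp [add_smul]; abel }).trans Θ.toAddEquiv
  map_smul' c w := by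
    change Θ (x.σ (Θ.symm (c • w)).1, x.σ (Θ.symm (c • w)).1 • t + x (Θ.symm (c • w)).2) =
      x.σ c • Θ (x.σ (Θ.symm w).1, x.σ (Θ.symm w).1 • t + x (Θ.symm w).2)
    rw [map_smul Θ.symm, ← map_smul Θ, Prod.smul_fst, Prod.smul_snd,
      apply_smul, smul_eq_mul, map_mul, mul_smul, ← smul_add, Prod.smul_mk, smul_eq_mul]

variable (Θ : (F × H) ≃ₗ[F] V)

@[simp] lemma affine_σ (t : H) (x : GammaL F H) : (affine Θ t x).σ = x.σ := rfl

@[simp] lemma affine_apply (t : H) (x : GammaL F H) (a : F) (w : H) :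
    affine Θ t x (Θ (a, w)) = Θ (x.σ a, x.σ a • t + x w) := by
  simp [affine]

lemma ext_of_splitting {x y : GammaL F V} (h : x.σ = y.σ)
    (h' : ∀ a w, x (Θ (a, w)) = y (Θ (a, w))) : x = y :=
  ext' h fun v => by
    obtain ⟨⟨a, w⟩, rfl⟩ := Θ.surjective v
    exact h' a w

lemma affine_mul (s t : H) (x y : GammaL F H) :
    affine Θ s x * affine Θ t y = affine Θ (s + x t) (x * y) := by
  refine ext_of_splitting Θ rfl fun a w => ?_
  have : ∀ v w : H, x (v + w) = x v + x w := map_add x.f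
  simp [this, apply_smul, add_assoc]

/-- The extension of semilinear bijections of a hyperplane that fixes a given complement. -/
def extend : GammaL F H →* GammaL F V :=
  MonoidHom.mk' (affine Θ 0) fun x y => by
    have : x 0 = 0 := map_zero x.f
    simp [affine_mul, this]

variable {Θ}

lemma affine_coe (hΘ : ∀ w, Θ (0, w) = (w : V))
    (t : H) (x : GammaL F H) (w : H) : affine Θ t x w = x w := by
  rw [← hΘ, affine_apply, ← hΘ]
  simp

lemma affine_smul_incl (hΘ : ∀ w, Θ (0, w) = (w : V)) (t : H) (x : GammaL F H) (P : ℙ F H) :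
    toPGammaL (affine Θ t x) • incl H P = incl H (toPGammaL x • P) := by
  induction P using Projectivization.ind with | h w hw =>
  change Projectivization.mk F (affine Θ t x w) _ = Projectivization.mk F (x w : V) _
  simp only [affine_coe hΘ]

lemma mem_of_splitting (hΘ : ∀ w, Θ (0, w) = (w : V))
    {a : F} {w : H} : Θ (a, w) ∈ H ↔ a = 0 := by
  constructor
  · intro h
    have : Θ (a, w) = Θ (0, ⟨_, h⟩) := (hΘ ⟨_, h⟩).symm
    exact (Prod.ext_iff.mp (Θ.injective this)).1
  · rintro rfl
    rw [hΘ]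
    exact w.2

/-- The image of `Θ (1, 0)` has a nonzero first coordinate `a`, since otherwise `y` would map all of
`V` into `H`. Dividing by `a` normalises that coordinate to `1`. Finiteness of `H` makes the
injective restriction of `y` to `H` bijective. -/
lemma exists_affine (hΘ : ∀ w, Θ (0, w) = (w : V))
    [Finite H] (y : GammaL F V) (hy : ∀ w : H, y w ∈ H) :
    ∃ (a : Fˣ) (t : H) (x : GammaL F H), y = scalar a * affine Θ t x := by
  have hadd : ∀ v w : V, y (v + w) = y v + y w := map_add y.f
  obtain ⟨⟨a, t⟩, hat⟩ := Θ.surjective (y (Θ (1, 0)))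
  have hdec : ∀ (b : F) (w : H), Θ (b, w) = b • Θ (1, 0) + w := fun b w => by
    rw [← hΘ w, ← map_smul, ← map_add]
    simp
  have ha : a ≠ 0 := by
    rintro rfl
    rw [hΘ] at hat
    obtain ⟨⟨b, w⟩, hbw⟩ := Θ.surjective (y⁻¹ (Θ (1, 0)))
    have h1 : y (Θ (b, w)) ∈ H := by
      rw [hdec, hadd, y.apply_smul, ← hat]
      exact H.add_mem (H.smul_mem _ t.2) (hy w)
    rw [hbw, apply_inv_apply, mem_of_splitting hΘ] at h1
    exact one_ne_zero h1
  let f : H →+ H :=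
    { toFun := fun w => a⁻¹ • ⟨y w, hy w⟩
      map_zero' := Subtype.ext (by simp [show y 0 = 0 from map_zero y.f])
      map_add' := fun v w => Subtype.ext (by simp [hadd]) }
  have hf : Function.Bijective f := Finite.injective_iff_bijective.mp fun v w h => by
    have h1 := smul_right_injective H (inv_ne_zero ha) h
    exact Subtype.ext (y.f.injective (congrArg Subtype.val h1))
  refine ⟨Units.mk0 a ha, a⁻¹ • t, ⟨y.σ, AddEquiv.ofBijective f hf, fun c w => ?_⟩, ?_⟩
  · refine Subtype.ext ?_
    have := y.apply_smul c w
    simp [f, this, smul_comm (y.σ c)]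
  · refine ext_of_splitting Θ rfl fun b w => ?_
    have h1 : (⟨y w, hy w⟩ : H) = a • f w := (smul_inv_smul₀ ha _).symm
    have h2 : y (Θ (b, w)) = Θ (y.σ b • (a, t) + (0, a • f w)) := by
      rw [map_add, hΘ, ← h1, map_smul, hat, hdec, hadd, y.apply_smul]
    have h3 : (y.σ b • (a, t) + (0, a • f w) : F × H) =
        a • (y.σ b, y.σ b • a⁻¹ • t + f w) := by
      ext
      · simp [mul_comm]
      · rw [smul_comm (y.σ b) a⁻¹ t]
        simp [ha]
    rw [h2, h3, map_smul]
    exact congrArg (a • ·)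
      (affine_apply Θ (a⁻¹ • t) ⟨y.σ, AddEquiv.ofBijective f hf, _⟩ b w).symm

/-- Two lifts of one collineation differ by a scalar, and both send `Θ (1, 0)` to a vector with
first coordinate `1`, so the scalar is `1`. -/
lemma affine_injective (hΘ : ∀ w, Θ (0, w) = (w : V))
    (hV : 2 ≤ Module.finrank F V) {s t : H} {x y : GammaL F H}
    (h : toPGammaL (affine Θ s x) = toPGammaL (affine Θ t y)) : s = t ∧ x = y := by
  obtain ⟨a, ha⟩ := eq_scalar_mul_of_toPGammaL_eq hV h
  have h1 : (affine Θ s x) (Θ (1, 0)) = (scalar a * affine Θ t y : GammaL F V) (Θ (1, 0)) := by rw [ha]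
  rw [mul_apply, scalar_apply, affine_apply, affine_apply, ← map_smul] at h1
  have h2 := Prod.ext_iff.mp (Θ.injective h1)
  have h0 : ∀ z : GammaL F H, z 0 = 0 := fun z => map_zero z.f
  simp only [map_one, one_smul, h0, add_zero, Prod.smul_mk, smul_eq_mul, mul_one] at h2
  obtain ⟨h2, h3⟩ := h2
  rw [← h2, one_smul] at h3
  refine ⟨h3, ext' ?_ fun w => Subtype.ext ?_⟩
  · have : (affine Θ s x).σ = (scalar a * affine Θ t y).σ := by rw [ha]
    simpa using this
  · rw [← affine_coe hΘ s, ← affine_coe hΘ t, ha, mul_apply, scalar_apply, ← h2, one_smul]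

lemma affine_mem_persp_iff (hΘ : ∀ w, Θ (0, w) = (w : V))
    (hH : 2 ≤ Module.finrank F H) (t : H) (x : GammaL F H) :
    toPGammaL (affine Θ t x) ∈ Persp H ↔ ∃ a, x = scalar a := by
  rw [mem_fixingSubgroup_iff]
  constructor
  · intro h
    apply eq_scalar_of_toPGammaL_eq_one hH
    ext P
    apply incl_injective
    have := h _ (mem_projectivization_iff.mpr ⟨P, rfl⟩)
    rw [affine_smul_incl hΘ] at this
    exact this
  · rintro ⟨a, rfl⟩ P hP
    obtain ⟨Q, rfl⟩ := mem_projectivization_iff.mp hP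
    rw [affine_smul_incl hΘ, toPGammaL_scalar, one_smul]

lemma affine_mem_stabilizer_iff (hΘ : ∀ w, Θ (0, w) = (w : V))
    (K : Set (ℙ F H)) (t : H) (x : GammaL F H) :
    toPGammaL (affine Θ t x) ∈ PGammaLStab (incl H '' K) ↔ toPGammaL x ∈ PGammaLStab K := by
  rw [MulAction.mem_stabilizer_iff, MulAction.mem_stabilizer_iff]
  have : toPGammaL (affine Θ t x) • incl H '' K = incl H '' (toPGammaL x • K) := by
    rw [← Set.image_smul, ← Set.image_smul, Set.image_image, Set.image_image]
    simp only [affine_smul_incl hΘ]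
  rw [this, Set.image_eq_image incl_injective]

end GammaL

end Hyperplane

/-! ### Perspectivities and the split extension -/

section Split

open GammaL

variable {F V ι : Type*} [Field F] [AddCommGroup V] [Module F V] {H : Submodule F V}
  [Fintype ι] [DecidableEq ι] {K : Set (ℙ F H)} {e : ι → H} {Θ : (F × H) ≃ₗ[F] V}

lemma exists_affine_of_mem_persp [Finite H] (hΘ : ∀ w, Θ (0, w) = (w : V))
    (hH : 2 ≤ Module.finrank F H) {g : PGammaL F V} (hg : g ∈ Persp H) :
    ∃ (t : H) (a : Fˣ), g = toPGammaL (affine Θ t (scalar a)) := by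
  obtain ⟨y, rfl⟩ := toPGammaL_surjective g
  have hy : ∀ w : H, y w ∈ H := by
    intro w
    by_cases hw : (w : V) = 0
    · rw [hw, show y 0 = 0 from map_zero y.f]
      exact H.zero_mem
    · have h1 := (mem_fixingSubgroup_iff _).mp hg (Projectivization.mk F (w : V) hw)
        ((Submodule.mk_mem_projectivization_iff H hw).mpr w.2)
      obtain ⟨c, hc⟩ := eigen_of_toPGammaL_smul hw h1
      rw [← hc]
      exact H.smul_mem _ w.2
  obtain ⟨a, t, x, rfl⟩ := exists_affine hΘ y hy
  rw [map_mul, toPGammaL_scalar, one_mul] at hg ⊢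
  obtain ⟨b, rfl⟩ := (affine_mem_persp_iff hΘ hH t x).mp hg
  exact ⟨t, b, rfl⟩

/-- A perspectivity is determined by a translation vector and a homothety of `H`; both are unique
because the first coordinate is normalised. -/
lemma card_persp [Finite H] (hΘ : ∀ w, Θ (0, w) = (w : V))
    (hH : 2 ≤ Module.finrank F H) (hV : 2 ≤ Module.finrank F V) :
    Nat.card (Persp H) = Nat.card H * Nat.card Fˣ := by
  have : Nontrivial H := Module.nontrivial_of_finrank_pos (R := F) (by lia)
  rw [← Nat.card_prod]
  symm
  refine Nat.card_eq_of_bijective (fun a : H × Fˣ =>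
    (⟨toPGammaL (affine Θ a.1 (scalar a.2)),
      (affine_mem_persp_iff hΘ hH _ _).mpr ⟨_, rfl⟩⟩ : Persp H)) ⟨?_, ?_⟩
  · rintro ⟨s, a⟩ ⟨t, b⟩ h
    obtain ⟨rfl, h1⟩ := affine_injective hΘ hV (congrArg Subtype.val h)
    obtain ⟨w, hw⟩ := exists_ne (0 : H)
    have h2 : (scalar a : GammaL F H) w = (scalar b : GammaL F H) w := by rw [h1]
    exact Prod.ext rfl (Units.ext (smul_left_injective F hw h2))
  · rintro ⟨g, hg⟩
    obtain ⟨t, a, rfl⟩ := exists_affine_of_mem_persp hΘ hH hg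
    exact ⟨(t, a), rfl⟩

/-- The vectors representing `K` span `H`, so a collineation that stabilises `K` also stabilises
`H`. -/
lemma IsRepresentation.exists_affine [Finite H] (he : IsRepresentation K e)
    (hΘ : ∀ w, Θ (0, w) = (w : V)) {g : PGammaL F V} (hg : g ∈ PGammaLStab (incl H '' K)) :
    ∃ (t : H) (x : GammaL F H), g = toPGammaL (affine Θ t x) ∧ toPGammaL x ∈ PGammaLStab K := by
  obtain ⟨y, rfl⟩ := toPGammaL_surjective g
  have hy : ∀ w : H, y w ∈ H := by
    intro w
    have hw : w ∈ Submodule.span F (Set.range e) := by rw [he.span_eq]; trivial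
    induction hw using Submodule.span_induction with
    | mem w hw =>
      obtain ⟨i, rfl⟩ := hw
      have h1 := (MulAction.mem_stabilizer_iff.mp hg).subset
        (Set.smul_mem_smul_set (Set.mem_image_of_mem (incl H) (he.mem i)))
      obtain ⟨Q, -, hQ⟩ := h1
      have h2 : toPGammaL y • incl H (Projectivization.mk F (e i) (he.ne_zero i)) ∈
        H.projectivization := mem_projectivization_iff.mpr ⟨Q, hQ⟩
      exact h2
    | zero => rw [ZeroMemClass.coe_zero, show y 0 = 0 from map_zero y.f]; exact H.zero_mem
    | add v w _ _ hv hw =>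
      rw [Submodule.coe_add, show y (v + w) = y v + y w from map_add y.f _ _]
      exact H.add_mem hv hw
    | smul c w _ hw =>
      rw [Submodule.coe_smul, y.apply_smul]
      exact H.smul_mem _ hw
  obtain ⟨a, t, x, rfl⟩ := GammaL.exists_affine hΘ y hy
  rw [map_mul, toPGammaL_scalar, one_mul] at hg ⊢
  exact ⟨t, x, rfl, (affine_mem_stabilizer_iff hΘ K t x).mp hg⟩

lemma persp_le_stabilizer : Persp H ≤ PGammaLStab (incl H '' K) := by
  intro g hg
  rw [MulAction.mem_stabilizer_iff, ← Set.image_smul, Set.image_image]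
  exact Set.image_congr fun P _ =>
    (mem_fixingSubgroup_iff _).mp hg _ (mem_projectivization_iff.mpr ⟨P, rfl⟩)

/-- The complement is the image of `S`, which extends the lifts `s g` so that `Θ (1, 0)` is fixed.
It meets `Persp H` trivially because `S g` restricts to `g` on `H`. -/
lemma IsRepresentation.exists_semidirectProduct [Finite H] (he : IsRepresentation K e)
    (hΘ : ∀ w, Θ (0, w) = (w : V)) (s : PGammaLStab K →* GammaL F H)
    (hs : ∀ g, toPGammaL (s g) = g) :
    ∃ (φ : PGammaLStab K →* MulAut (Persp H))
      (e : Persp H ⋊[φ] PGammaLStab K ≃* PGammaLStab (incl H '' K)),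
      (∀ x : Persp H, ((e (SemidirectProduct.inl x) : PGammaLStab (incl H '' K)) :
        PGammaL F V) = x) ∧
      ∀ (g : PGammaLStab K) (P : ℙ F H),
        e (SemidirectProduct.inr g) • incl H P = incl H (g • P) := by
  let S : PGammaLStab K →* PGammaL F V := toPGammaL.comp ((extend Θ).comp s)
  have hS : ∀ g P, S g • incl H P = incl H (g • P) := fun g P => by
    change toPGammaL (affine Θ 0 (s g)) • incl H P = _
    rw [affine_smul_incl hΘ, hs]
    rfl
  have hSt : ∀ g, S g ∈ PGammaLStab (incl H '' K) := fun g =>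
    (affine_mem_stabilizer_iff hΘ K 0 (s g)).mpr (by rw [hs]; exact g.2)
  have hconj : ∀ g, ∀ x ∈ Persp H, S g * x * (S g)⁻¹ ∈ Persp H := by
    intro g x hx
    rw [mem_fixingSubgroup_iff]
    intro P hP
    obtain ⟨Q, rfl⟩ := mem_projectivization_iff.mp hP
    rw [← map_inv, mul_smul, mul_smul, hS,
      (mem_fixingSubgroup_iff _).mp hx _ (mem_projectivization_iff.mpr ⟨_, rfl⟩), hS,
      smul_inv_smul]
  have hN : ∀ g, S g ∈ Subgroup.normalizer (Persp H : Set (PGammaL F V)) := fun g x =>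
    ⟨hconj g x, fun h => by
      have := hconj g⁻¹ _ h
      rwa [map_inv, inv_inv, mul_assoc, inv_mul_cancel_right,
        inv_mul_cancel_left] at this⟩
  let φ : PGammaLStab K →* MulAut (Persp H) :=
    (Persp H).normalizerMonoidHom.comp (S.codRestrict _ hN)
  let f : Persp H ⋊[φ] PGammaLStab K →* PGammaLStab (incl H '' K) :=
    SemidirectProduct.lift (Subgroup.inclusion persp_le_stabilizer) (S.codRestrict _ hSt)
      fun g => by ext x; rfl
  have hf : ∀ x, ((f x : PGammaLStab (incl H '' K)) : PGammaL F V) = x.left * S x.right :=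
    fun _ => rfl
  have hbij : Function.Bijective f := by
    constructor
    · rw [injective_iff_map_eq_one]
      intro x hx
      have h1 : (x.left : PGammaL F V) * S x.right = 1 := by rw [← hf, hx]; rfl
      have h2 : x.right = 1 := by
        ext P
        apply incl_injective
        have h3 : ((x.left : PGammaL F V) * S x.right) • incl H P = incl H P := by
          rw [h1, one_smul]
        rw [mul_smul, hS,
          (mem_fixingSubgroup_iff _).mp x.left.2 _ (mem_projectivization_iff.mpr ⟨_, rfl⟩)] at h3
        exact h3
      rw [h2, map_one, mul_one] at h1
      exact SemidirectProduct.ext (Subtype.ext h1) h2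
    · rintro ⟨g, hg⟩
      obtain ⟨t, x, rfl, hx⟩ := he.exists_affine hΘ hg
      -- `S` of the restriction to `H` agrees there with the given collineation, so the quotient of
      -- the two is a perspectivity.
      have hmem : toPGammaL (affine Θ t x) * (S ⟨_, hx⟩)⁻¹ ∈ Persp H := by
        rw [mem_fixingSubgroup_iff]
        intro P hP
        obtain ⟨Q, rfl⟩ := mem_projectivization_iff.mp hP
        rw [← map_inv, mul_smul, hS, affine_smul_incl hΘ]
        exact congrArg (incl H) (smul_inv_smul (⟨_, hx⟩ : PGammaLStab K) Q)
      exact ⟨⟨⟨_, hmem⟩, ⟨_, hx⟩⟩, Subtype.ext (by rw [hf, inv_mul_cancel_right])⟩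
  refine ⟨φ, MulEquiv.ofBijective f hbij, fun x => ?_, fun g P => ?_⟩
  · change ((f _ : PGammaLStab (incl H '' K)) : PGammaL F V) = x
    rw [hf]
    simp
  · change ((f _ : PGammaLStab (incl H '' K)) : PGammaL F V) • incl H P = _
    rw [hf]
    simp [hS]

end Split

/-! ### The stabiliser of a frame and of a basis -/

/-- Every ring automorphism fixes the prime field, so this is the order of the Galois group of `F`
over `ZMod p`, that is, the degree `h`. -/
lemma card_ringAut {F : Type*} [Field F] [Finite F] {p h : ℕ} (hp : p.Prime)
    (hF : Nat.card F = p ^ h) : Nat.card (RingAut F) = h := by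
  have : Fact p.Prime := ⟨hp⟩
  have : Fintype F := Fintype.ofFinite F
  have : CharP F p := by
    obtain ⟨r, hr⟩ := CharP.exists F
    obtain ⟨k, hrp, hk⟩ := FiniteField.card F r
    rw [Nat.card_eq_fintype_card, hk] at hF
    have : r ∣ p ^ h := hF ▸ dvd_pow_self r k.ne_zero
    rwa [(Nat.prime_dvd_prime_iff_eq hrp hp).mp (hrp.dvd_of_dvd_pow this)] at hr
  let _ : Algebra (ZMod p) F := ZMod.algebra F p
  have h1 : Module.finrank (ZMod p) F = h := by
    have := Module.natCard_eq_pow_finrank (K := ZMod p) (V := F)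
    rw [hF, Nat.card_zmod] at this
    exact (Nat.pow_right_injective hp.two_le this).symm
  rw [← h1, ← IsGalois.card_aut_eq_finrank]
  exact Nat.card_congr
    { toFun := fun σ => AlgEquiv.ofRingEquiv (f := σ) fun x =>
        RingHom.congr_fun (Subsingleton.elim ((σ : F →+* F).comp (algebraMap (ZMod p) F)) _) x
      invFun := fun σ => σ.toRingEquiv
      left_inv := fun _ => rfl
      right_inv := fun _ => rfl }

section Groups

open GammaL

variable {F W ι : Type*} [Field F] [AddCommGroup W] [Module F W] [Fintype ι] [DecidableEq ι]
  {K : Set (ℙ F W)}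

/-- The collineation stabiliser of a frame is `Sym × Aut(F)`. -/
lemma IsRepresentation.nonempty_mulEquiv_frame {e : ι → W} (he : IsRepresentation K e)
    (hW : 2 ≤ Module.finrank F W) (hsum : ∑ i, e i = 0)
    (hrel : ∀ c : ι → F, ∑ i, c i • e i = 0 → ∀ i j, c i = c j) :
    Nonempty (PGammaLStab K ≃*
      Equiv.Perm ι ⋊[(1 : RingAut F →* MulAut (Equiv.Perm ι))] RingAut F) := by
  have : Nontrivial W := Module.nontrivial_of_finrank_pos (R := F) (by lia)
  have hne : Nonempty ι := by
    by_contra h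
    rw [not_nonempty_iff] at h
    have h1 := he.span_eq
    rw [Set.range_eq_empty, Submodule.span_empty] at h1
    exact bot_ne_top h1
  choose x hxσ hx using he.permute
  have hst : ∀ σ π, toPGammaL (x σ π) ∈ PGammaLStab K := fun σ π =>
    (he.mem_stabilizer_iff _).mpr ⟨1, π, fun i => by simp [hx]⟩
  let f : Equiv.Perm ι ⋊[(1 : RingAut F →* MulAut (Equiv.Perm ι))] RingAut F →* PGammaLStab K :=
    MonoidHom.mk' (fun a => ⟨_, hst a.right a.left⟩) fun a b => Subtype.ext (by
      change toPGammaL _ = toPGammaL _ * toPGammaL _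
      rw [← map_mul]
      congr 1
      refine ext_of_span he.span_eq ?_ fun i => ?_
      · rw [mul_σ, hxσ, hxσ, hxσ]; rfl
      · rw [mul_apply, hx, hx, hx]; rfl)
  refine ⟨(MulEquiv.ofBijective f ⟨?_, ?_⟩).symm⟩
  · rintro ⟨π, σ⟩ ⟨ρ, τ⟩ h
    obtain ⟨a, ha⟩ := eq_scalar_mul_of_toPGammaL_eq hW (congrArg Subtype.val h)
    ext1
    · ext i
      have h1 : x σ π (e i) = (scalar a * x τ ρ : GammaL F W) (e i) := by rw [ha]
      rw [mul_apply, hx, hx, scalar_apply, ← one_smul F (e _)] at h1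
      exact (he.smul_eq_smul one_ne_zero h1).1
    · rw [← hxσ σ π, ha, mul_σ, scalar_σ, one_mul, hxσ]
  · rintro ⟨g, hg⟩
    obtain ⟨y, rfl⟩ := toPGammaL_surjective g
    obtain ⟨c, π, hc⟩ := (he.mem_stabilizer_iff y).mp hg
    obtain ⟨j⟩ := hne
    -- Applying `y` to `∑ e i = 0` gives a relation with coefficients `c (π⁻¹ i)`. These must be
    -- equal, so `y` is a scalar times the chosen lift of `π` and `y.σ`.
    have h1 : ∑ i, (c (π.symm i) : F) • e i = 0 := by
      rw [← Equiv.sum_comp π]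
      simp only [Equiv.symm_apply_apply, ← hc]
      rw [← map_sum y.f, hsum, map_zero]
    have h2 : ∀ i, (c i : F) = c j := fun i => by
      have := hrel _ h1 (π i) (π j)
      simpa using this
    refine ⟨⟨π, y.σ⟩, Subtype.ext ?_⟩
    change toPGammaL (x y.σ π) = toPGammaL y
    have h3 : y = scalar (c j) * x y.σ π := by
      refine ext_of_span he.span_eq ?_ fun i => ?_
      · rw [mul_σ, hxσ]; rfl
      · rw [mul_apply, hx, scalar_apply, hc, h2]
    conv_rhs => rw [h3, map_mul, toPGammaL_scalar, one_mul]

/-- A linear bijection as a semilinear bijection. -/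
def ofLinearEquiv (T : W ≃ₗ[F] W) : GammaL F W := ⟨1, T.toAddEquiv, T.map_smul⟩

/-- The action of invertible matrices on the coordinates with respect to a basis. -/
noncomputable def ofMatrix (b : Module.Basis ι F W) : GL ι F →* GammaL F W :=
  MonoidHom.mk' (fun M => ofLinearEquiv (LinearEquiv.ofLinearMap
      (Matrix.toLin b b (M : Matrix ι ι F)) (Matrix.toLin b b ((M⁻¹ : GL ι F) : Matrix ι ι F))
      (by rw [← Matrix.toLin_mul, ← Units.val_mul, mul_inv_cancel, Units.val_one, Matrix.toLin_one])
      (by rw [← Matrix.toLin_mul, ← Units.val_mul, inv_mul_cancel, Units.val_one,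
        Matrix.toLin_one])))
    fun M N => GammaL.ext' (one_mul (1 : RingAut F)).symm fun w => by
      change Matrix.toLin b b ((M * N : GL ι F) : Matrix ι ι F) w =
        Matrix.toLin b b (M : Matrix ι ι F) (Matrix.toLin b b (N : Matrix ι ι F) w)
      rw [Units.val_mul, Matrix.toLin_mul b b b, LinearMap.comp_apply]

lemma ofMatrix_apply (b : Module.Basis ι F W) (M : GL ι F) (j : ι) :
    ofMatrix b M (b j) = ∑ i, M i j • b i :=
  Matrix.toLin_self b b _ j

lemma exists_ofMatrix_eq (b : Module.Basis ι F W) (y : GammaL F W) (hy : y.σ = 1) :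
    ∃ M : GL ι F, ofMatrix b M = y := by
  have hlin : ∀ z : GammaL F W, z.σ = 1 → ∃ T : W →ₗ[F] W, ∀ w, T w = z w := fun z hz =>
    ⟨{ toFun := z.f, map_add' := map_add z.f
       map_smul' := fun c w => by rw [z.map_smul' c w, hz]; rfl }, fun _ => rfl⟩
  obtain ⟨T, hT⟩ := hlin y hy
  obtain ⟨T', hT'⟩ := hlin y⁻¹ (by
    have : (y * y⁻¹).σ = 1 := by rw [mul_inv_cancel]; rfl
    rwa [mul_σ, hy, one_mul] at this)
  refine ⟨⟨LinearMap.toMatrix b b T, LinearMap.toMatrix b b T', ?_, ?_⟩, ?_⟩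
  · rw [← LinearMap.toMatrix_comp, ← LinearMap.toMatrix_id b]
    congr 1
    ext w
    simp [hT, hT']
  · rw [← LinearMap.toMatrix_comp, ← LinearMap.toMatrix_id b]
    congr 1
    ext w
    simp [hT, hT']
  · refine GammaL.ext' hy.symm fun w => ?_
    change Matrix.toLin b b (LinearMap.toMatrix b b T) w = y w
    rw [Matrix.toLin_toMatrix, hT]

lemma IsRepresentation.ofMatrix_mem_stabilizer_iff {b : Module.Basis ι F W}
    (he : IsRepresentation K b) (M : GL ι F) :
    toPGammaL (ofMatrix b M) ∈ PGammaLStab K ↔ M ∈ monomial ι F := by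
  rw [he.mem_stabilizer_iff]
  constructor
  · rintro ⟨c, π, hc⟩
    have hM : ∀ i j, M i j ≠ 0 ↔ π j = i := by
      intro i j
      have h1 := congrArg (fun w => b.repr w i) (hc j)
      rw [ofMatrix_apply] at h1
      simp only [b.repr_sum_self, map_smul, Module.Basis.repr_self, Finsupp.smul_apply,
        Finsupp.single_apply] at h1
      rw [h1]
      simp
    refine ⟨fun i => ⟨π.symm i, (hM _ _).mpr (by simp), fun j hj => ?_⟩,
      fun j => ⟨π j, (hM _ _).mpr rfl, fun i hi => ((hM _ _).mp hi).symm⟩⟩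
    rw [← (hM _ _).mp hj, Equiv.symm_apply_apply]
  · rintro ⟨hr, hc⟩
    choose u hu hu' using hc
    have hinj : Function.Injective u := fun i j hij =>
      (hr (u i)).unique (hu i) (by rw [hij]; exact hu j)
    refine ⟨fun j => Units.mk0 _ (hu j),
      Equiv.ofBijective u (Finite.injective_iff_bijective.mp hinj), fun j => ?_⟩
    rw [ofMatrix_apply]
    refine Finset.sum_eq_single _ (fun i _ hi => ?_) (by simp)
    by_contra h
    exact hi (hu' j i fun h0 => h (by rw [h0, zero_smul]))

/-- The collineation stabiliser of a basis is `PMon ⋊ Aut(F)`. -/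
lemma IsRepresentation.nonempty_mulEquiv_basis {b : Module.Basis ι F W}
    (he : IsRepresentation K b) (hW : 2 ≤ Module.finrank F W) :
    Nonempty (PGammaLStab K ≃* PMon ι F ⋊[fieldAction ι F] RingAut F) := by
  let f₁ : PMon ι F →* PGammaLStab K :=
    QuotientGroup.lift _ (((toPGammaL.comp (ofMatrix b)).comp (monomial ι F).subtype).codRestrict
      (PGammaLStab K) fun M => (he.ofMatrix_mem_stabilizer_iff M).mpr M.2) (by
      rintro ⟨M, hM⟩ ⟨a, ha⟩
      change Matrix.GeneralLinearGroup.scalar ι a = M at ha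
      subst ha
      refine Subtype.ext ?_
      change toPGammaL (ofMatrix b _) = 1
      rw [← toPGammaL_scalar (W := W) a]
      congr 1
      refine ext_of_span b.span_eq rfl fun j => ?_
      rw [ofMatrix_apply]
      simp [Matrix.diagonal_apply])
  let fr : RingAut F →* GammaL F W := MonoidHom.mk' (fun σ => ofBasis b b σ) fun σ τ =>
    ext_of_span b.span_eq rfl fun i => by simp [ofBasis_apply]
  have hfr : ∀ σ i, fr σ (b i) = b i := fun σ i => ofBasis_apply b b σ i
  let f₂ : RingAut F →* PGammaLStab K := (toPGammaL.comp fr).codRestrict _ fun σ =>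
    (he.mem_stabilizer_iff _).mpr ⟨1, 1, fun i => by simp [hfr]⟩
  have hcomm : ∀ σ, f₁.comp (fieldAction ι F σ).toMonoidHom =
      (MulAut.conj (f₂ σ)).toMonoidHom.comp f₁ := by
    intro σ
    ext1
    ext1 M
    refine Subtype.ext ?_
    change toPGammaL (ofMatrix b (monomialMap ι σ M)) =
      toPGammaL (fr σ) * toPGammaL (ofMatrix b M) * (toPGammaL (fr σ))⁻¹
    -- Cleared of the inverse, the identity concerns semilinear maps and can be checked on the
    -- basis, which `fr σ` fixes.
    rw [eq_mul_inv_iff_mul_eq, ← map_mul, ← map_mul]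
    congr 1
    refine ext_of_span b.span_eq rfl fun j => ?_
    rw [mul_apply, mul_apply, hfr, ofMatrix_apply, ofMatrix_apply, apply_sum_smul]
    simp only [hfr]
    rfl
  let f := SemidirectProduct.lift f₁ f₂ hcomm
  have hf : ∀ (M : monomial ι F) (σ : RingAut F), ((f ⟨QuotientGroup.mk M, σ⟩ : PGammaLStab K) :
      PGammaL F W) = toPGammaL (ofMatrix b M * fr σ) := fun M σ => by
    rw [map_mul]
    rfl
  refine ⟨(MulEquiv.ofBijective f ⟨?_, ?_⟩).symm⟩
  · rw [injective_iff_map_eq_one]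
    rintro ⟨⟨M⟩, σ⟩ h
    have h1 := hf M σ
    erw [h] at h1
    obtain ⟨a, ha⟩ := eq_scalar_of_toPGammaL_eq_one hW h1.symm
    have hσ : σ = 1 := by
      have : (ofMatrix b M * fr σ).σ = 1 := by rw [ha, scalar_σ]
      exact this
    refine SemidirectProduct.ext ?_ hσ
    refine (QuotientGroup.eq_one_iff M).mpr ⟨a, ?_⟩
    ext i j
    have h2 := congrArg (fun z : GammaL F W => b.repr (z (b j)) i) ha
    simp only [mul_apply, hfr, ofMatrix_apply, scalar_apply] at h2
    rw [b.repr_sum_self] at h2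
    change Matrix.GeneralLinearGroup.scalar ι a i j = _
    erw [h2]
    simp [Matrix.diagonal_apply, Finsupp.single_apply, eq_comm]
  · rintro ⟨g, hg⟩
    obtain ⟨y, rfl⟩ := toPGammaL_surjective g
    obtain ⟨M, hM⟩ := exists_ofMatrix_eq b (y * (fr y.σ)⁻¹) (mul_inv_cancel y.σ)
    have hM' : M ∈ monomial ι F := by
      rw [← he.ofMatrix_mem_stabilizer_iff, hM, map_mul, map_inv]
      exact mul_mem hg (inv_mem (f₂ y.σ).2)
    refine ⟨⟨QuotientGroup.mk ⟨M, hM'⟩, y.σ⟩, Subtype.ext ?_⟩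
    rw [hf]
    change toPGammaL (ofMatrix b M * fr y.σ) = toPGammaL y
    rw [hM, inv_mul_cancel_right]

/-- Each collineation has exactly one lift whose coefficient at index `0` is `1`. This leaves `n`
free units, a permutation and a field automorphism. -/
lemma IsRepresentation.card_stabilizer_basis {n : ℕ} {b : Module.Basis (Fin (n + 1)) F W}
    (he : IsRepresentation K b) (hW : 2 ≤ Module.finrank F W) :
    Nat.card (PGammaLStab K) =
      Nat.card Fˣ ^ n * (n + 1).factorial * Nat.card (RingAut F) := by
  let X : (Fin n → Fˣ) → Equiv.Perm (Fin (n + 1)) → RingAut F → GammaL F W := fun c π σ =>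
    ofBasis b ((b.reindex π.symm).unitsSMul (Fin.cons 1 c)) σ
  have hX : ∀ c π σ i, X c π σ (b i) = ((Fin.cons 1 c : Fin (n + 1) → Fˣ) i : F) • b (π i) :=
    fun c π σ i => by
      simp only [X]
      rw [ofBasis_apply, Module.Basis.unitsSMul_apply]
      simp [Units.smul_def]
  have hst : ∀ c π σ, toPGammaL (X c π σ) ∈ PGammaLStab K := fun c π σ =>
    (he.mem_stabilizer_iff _).mpr ⟨_, π, hX c π σ⟩
  have h1 : Nat.card (((Fin n → Fˣ) × Equiv.Perm (Fin (n + 1))) × RingAut F) =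
      Nat.card (PGammaLStab K) := by
    refine Nat.card_eq_of_bijective (fun a => ⟨_, hst a.1.1 a.1.2 a.2⟩) ⟨?_, ?_⟩
    · rintro ⟨⟨c, π⟩, σ⟩ ⟨⟨d, ρ⟩, τ⟩ h
      obtain ⟨a, ha⟩ := eq_scalar_mul_of_toPGammaL_eq hW (congrArg Subtype.val h)
      have h1 : ∀ i, π i = ρ i ∧ (((Fin.cons 1 c : Fin (n + 1) → Fˣ) i : Fˣ) : F) =
          a * ((Fin.cons 1 d : Fin (n + 1) → Fˣ) i : Fˣ) := fun i => by
        have h2 : X c π σ (b i) = (scalar a * X d ρ τ : GammaL F W) (b i) := by rw [ha]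
        rw [mul_apply, hX, hX, scalar_apply, smul_smul] at h2
        exact he.smul_eq_smul (Units.ne_zero _) h2
      have h3 : (a : F) = 1 := by simpa using (h1 0).2.symm
      obtain rfl : π = ρ := Equiv.ext fun i => (h1 i).1
      obtain rfl : c = d := funext fun i => Units.ext (by simpa [h3] using (h1 i.succ).2)
      have h4 : (X c π σ).σ = (scalar a * X c π τ : GammaL F W).σ := by rw [ha]
      exact Prod.ext rfl h4
    · rintro ⟨g, hg⟩
      obtain ⟨y, rfl⟩ := toPGammaL_surjective g
      obtain ⟨c, π, hc⟩ := (he.mem_stabilizer_iff y).mp hg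
      refine ⟨((fun i => (c 0)⁻¹ * c i.succ, π), y.σ), Subtype.ext ?_⟩
      have h3 : y = scalar (c 0) * X (fun i => (c 0)⁻¹ * c i.succ) π y.σ := by
        refine ext_of_span b.span_eq rfl fun i => ?_
        rw [mul_apply, hX, scalar_apply, hc, smul_smul]
        congr 1
        refine Fin.cases ?_ (fun i => ?_) i <;> simp
      change toPGammaL (X _ π y.σ) = toPGammaL y
      conv_rhs => rw [h3, map_mul, toPGammaL_scalar, one_mul]
  rw [← h1, Nat.card_prod, Nat.card_prod, Nat.card_perm, Nat.card_fun]
  simp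

end Groups

/-! ### Affine coordinates on the linear representation -/

section Coordinates

open GammaL

variable {F V ι : Type*} [Field F] [AddCommGroup V] [Module F V] {H : Submodule F V}
  [Fintype ι] [DecidableEq ι] {K : Set (ℙ F H)} {e : ι → H} {Θ : (F × H) ≃ₗ[F] V}

lemma splitting_ne_zero (Θ : (F × H) ≃ₗ[F] V) (w : H) : Θ (1, w) ≠ 0 := by
  intro h
  have := (map_eq_zero_iff Θ Θ.injective).mp h
  exact one_ne_zero (Prod.ext_iff.mp this).1

/-- The affine point with coordinate vector `w`. -/
def affinePoint (hΘ : ∀ w, Θ (0, w) = (w : V)) (w : H) : AffinePoint H :=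
  ⟨Projectivization.mk F (Θ (1, w)) (splitting_ne_zero Θ w), fun h =>
    one_ne_zero ((mem_of_splitting hΘ).mp
      ((Submodule.mk_mem_projectivization_iff H (splitting_ne_zero Θ w)).mp h))⟩

lemma affinePoint_injective (hΘ : ∀ w, Θ (0, w) = (w : V)) :
    Function.Injective (affinePoint hΘ) := by
  intro v w h
  obtain ⟨c, hc⟩ := (Projectivization.mk_eq_mk_iff' F _ _ _ _).mp (congrArg Subtype.val h)
  rw [← map_smul] at hc
  obtain ⟨h1, h2⟩ := Prod.ext_iff.mp (Θ.injective hc)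
  simp only [Prod.smul_mk, smul_eq_mul, mul_one] at h1 h2
  rw [← h2, h1, one_smul]

lemma affinePoint_surjective (hΘ : ∀ w, Θ (0, w) = (w : V)) :
    Function.Surjective (affinePoint hΘ) := by
  rintro ⟨P, hP⟩
  induction P using Projectivization.ind with | h v hv =>
  obtain ⟨⟨a, w⟩, rfl⟩ := Θ.surjective v
  have ha : a ≠ 0 := fun h => hP ((mem_of_splitting hΘ).mpr h)
  refine ⟨a⁻¹ • w, Subtype.ext ((Projectivization.mk_eq_mk_iff' F _ _ _ _).mpr ⟨a⁻¹, ?_⟩)⟩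
  rw [← map_smul]
  simp [ha]

lemma affine_smul_affinePoint (hΘ : ∀ w, Θ (0, w) = (w : V)) (t : H) (x : GammaL F H) (w : H) :
    toPGammaL (affine Θ t x) • (affinePoint hΘ w).1 = (affinePoint hΘ (t + x w)).1 := by
  simp only [affinePoint, toPGammaL_smul_mk, affine_apply, map_one, one_smul]

/-- The line through the affine point `w` and the point of `K` represented by `e i`. -/
def directedLine (he : IsRepresentation K e) (hΘ : ∀ w, Θ (0, w) = (w : V)) (i : ι) (w : H) :
    RepLine H K :=
  ⟨(Submodule.span F (Set.range ![Θ (1, w), (e i : V)])).projectivization, by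
    refine ⟨?_, ⟨_, he.mem i, ?_⟩, fun h => ?_⟩
    · rw [OrderIso.apply_symm_apply, finrank_span_eq_card]
      · simp
      · rw [LinearIndependent.pair_iff]
        intro a b hab
        rw [← hΘ, ← map_smul, ← map_smul, ← map_add,
          map_eq_zero_iff Θ Θ.injective, Prod.ext_iff] at hab
        obtain ⟨h1, h2⟩ := hab
        obtain rfl : a = 0 := by simpa using h1
        refine ⟨rfl, ?_⟩
        simpa [he.ne_zero i] using h2
    · exact Submodule.subset_span ⟨1, rfl⟩
    · have h1 := h (x := (affinePoint hΘ w).1) (Submodule.subset_span ⟨0, rfl⟩)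
      exact (affinePoint hΘ w).2 h1⟩

lemma affinePoint_mem_directedLine (he : IsRepresentation K e) (hΘ : ∀ w, Θ (0, w) = (w : V))
    (i : ι) (w v : H) :
    (affinePoint hΘ v).1 ∈ (directedLine he hΘ i w).1 ↔ ∃ t : F, v = w + t • e i := by
  change Θ (1, v) ∈ Submodule.span F (Set.range ![Θ (1, w), (e i : V)]) ↔ _
  rw [Matrix.range_cons, Matrix.range_cons, Matrix.range_empty, Set.union_empty,
    Set.singleton_union, Submodule.mem_span_pair]
  have key : ∀ a b : F, a • Θ (1, w) + b • (e i : V) = Θ (a, a • w + b • e i) := fun a b => by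
    rw [← hΘ, ← map_smul, ← map_smul, ← map_add]
    simp
  simp only [key, Θ.injective.eq_iff, Prod.mk.injEq]
  constructor
  · rintro ⟨a, b, rfl, rfl⟩
    exact ⟨b, by rw [one_smul]⟩
  · rintro ⟨t, rfl⟩
    exact ⟨1, t, rfl, by rw [one_smul]⟩

lemma eq_directedLine (he : IsRepresentation K e) (hΘ : ∀ w, Θ (0, w) = (w : V)) {L : RepLine H K}
    {i : ι} {w : H} (hw : (affinePoint hΘ w).1 ∈ L.1)
    (hi : incl H (Projectivization.mk F (e i) (he.ne_zero i)) ∈ L.1) :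
    L = directedLine he hΘ i w := by
  apply Subtype.ext
  apply Projectivization.Subspace.submodule.injective
  symm
  have hd := (directedLine he hΘ i w).2.1
  have : Module.Finite F (Projectivization.Subspace.submodule L.1) :=
    Module.finite_of_finrank_pos (by rw [L.2.1]; lia)
  refine Submodule.eq_of_le_of_finrank_eq ?_ (by rw [hd, L.2.1])
  change Projectivization.Subspace.submodule (Submodule.projectivization _) ≤ _
  rw [OrderIso.apply_symm_apply, Submodule.span_le]
  rintro _ ⟨j, rfl⟩
  fin_cases j
  · exact fun _ => hw
  · exact fun _ => hi

lemma exists_eq_directedLine (he : IsRepresentation K e) (hΘ : ∀ w, Θ (0, w) = (w : V))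
    {L : RepLine H K} {w : H} (hw : (affinePoint hΘ w).1 ∈ L.1) :
    ∃ i, L = directedLine he hΘ i w := by
  obtain ⟨P, hP, hPL⟩ := L.2.2.1
  obtain ⟨i, rfl⟩ := (he.mem_iff P).mp hP
  exact ⟨i, eq_directedLine he hΘ hw hPL⟩

lemma directedLine_surjective (he : IsRepresentation K e) (hΘ : ∀ w, Θ (0, w) = (w : V))
    (L : RepLine H K) : ∃ i w, L = directedLine he hΘ i w := by
  obtain ⟨P, hP, hPH⟩ := SetLike.not_le_iff_exists.mp L.2.2.2
  obtain ⟨w, hw⟩ := affinePoint_surjective hΘ ⟨P, hPH⟩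
  have : (affinePoint hΘ w).1 ∈ L.1 := by rw [hw]; exact hP
  obtain ⟨i, hi⟩ := exists_eq_directedLine he hΘ this
  exact ⟨i, w, hi⟩

lemma self_mem_directedLine (he : IsRepresentation K e) (hΘ : ∀ w, Θ (0, w) = (w : V)) (i : ι)
    (w : H) : (affinePoint hΘ w).1 ∈ (directedLine he hΘ i w).1 :=
  (affinePoint_mem_directedLine he hΘ i w w).mpr ⟨0, by simp⟩

lemma directedLine_injective (he : IsRepresentation K e) (hΘ : ∀ w, Θ (0, w) = (w : V)) (w : H) :
    Function.Injective fun i => directedLine he hΘ i w := by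
  intro i j h
  have h1 : (affinePoint hΘ (w + (1 : F) • e i)).1 ∈ (directedLine he hΘ j w).1 := by
    rw [← show directedLine he hΘ i w = directedLine he hΘ j w from h,
      affinePoint_mem_directedLine]
    exact ⟨1, rfl⟩
  obtain ⟨t, ht⟩ := (affinePoint_mem_directedLine he hΘ j w _).mp h1
  exact (he.smul_eq_smul one_ne_zero (add_left_cancel ht)).1

lemma directedLine_add_smul (he : IsRepresentation K e) (hΘ : ∀ w, Θ (0, w) = (w : V)) (i : ι)
    (w : H) (t : F) : directedLine he hΘ i (w + t • e i) = directedLine he hΘ i w := by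
  symm
  exact eq_directedLine he hΘ ((affinePoint_mem_directedLine he hΘ i w _).mpr ⟨t, rfl⟩)
    (Submodule.subset_span ⟨1, rfl⟩)

lemma adj_iff (he : IsRepresentation K e) (hΘ : ∀ w, Θ (0, w) = (w : V)) (i : ι) (v w : H) :
    (incidenceGraph H K).Adj (.inl (affinePoint hΘ v)) (.inr (directedLine he hΘ i w)) ↔
      ∃ t : F, v = w + t • e i :=
  affinePoint_mem_directedLine he hΘ i w v

lemma adj_self (he : IsRepresentation K e) (hΘ : ∀ w, Θ (0, w) = (w : V)) (i : ι) (w : H) :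
    (incidenceGraph H K).Adj (.inl (affinePoint hΘ w)) (.inr (directedLine he hΘ i w)) :=
  self_mem_directedLine he hΘ i w

lemma adj_point_iff (he : IsRepresentation K e) (hΘ : ∀ w, Θ (0, w) = (w : V)) (w : H)
    (y : AffinePoint H ⊕ RepLine H K) :
    (incidenceGraph H K).Adj (.inl (affinePoint hΘ w)) y ↔
      ∃ i, y = .inr (directedLine he hΘ i w) := by
  constructor
  · intro h
    rcases y with P | L
    · exact h.elim
    · obtain ⟨i, rfl⟩ := exists_eq_directedLine he hΘ (w := w) h
      exact ⟨i, rfl⟩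
  · rintro ⟨i, rfl⟩
    exact adj_self he hΘ i w

lemma adj_line_iff (he : IsRepresentation K e) (hΘ : ∀ w, Θ (0, w) = (w : V)) (i : ι) (w : H)
    (y : AffinePoint H ⊕ RepLine H K) :
    (incidenceGraph H K).Adj (.inr (directedLine he hΘ i w)) y ↔
      ∃ t : F, y = .inl (affinePoint hΘ (w + t • e i)) := by
  constructor
  · intro h
    rcases y with P | L
    · obtain ⟨v, rfl⟩ := affinePoint_surjective hΘ P
      obtain ⟨t, rfl⟩ := (affinePoint_mem_directedLine he hΘ i w v).mp h
      exact ⟨t, rfl⟩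
    · exact h.elim
  · rintro ⟨t, rfl⟩
    exact (affinePoint_mem_directedLine he hΘ i w _).mpr ⟨t, rfl⟩

/-- The graph of a linear representation of `|F|` points is regular. -/
lemma IsRepresentation.regular [Finite F] (he : IsRepresentation K e)
    (hΘ : ∀ w, Θ (0, w) = (w : V)) (hι : Fintype.card ι = Nat.card F)
    (x : AffinePoint H ⊕ RepLine H K) :
    ((incidenceGraph H K).neighborSet x).encard = Nat.card F := by
  rcases x with P | L
  · obtain ⟨w, rfl⟩ := affinePoint_surjective hΘ P
    have : (incidenceGraph H K).neighborSet (.inl (affinePoint hΘ w)) =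
        Set.range fun i => (.inr (directedLine he hΘ i w) : AffinePoint H ⊕ RepLine H K) := by
      ext y
      rw [SimpleGraph.mem_neighborSet, adj_point_iff he]
      exact exists_congr fun _ => eq_comm
    rw [this, ← Set.image_univ, Function.Injective.encard_image fun i j h =>
      directedLine_injective he hΘ w (Sum.inr_injective h), ← hι, Set.encard_univ]
    simp
  · obtain ⟨i, w, rfl⟩ := directedLine_surjective he hΘ L
    have : (incidenceGraph H K).neighborSet (.inr (directedLine he hΘ i w)) =
        Set.range fun t : F =>
          (.inl (affinePoint hΘ (w + t • e i)) : AffinePoint H ⊕ RepLine H K) := by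
      ext y
      rw [SimpleGraph.mem_neighborSet, adj_line_iff]
      exact exists_congr fun _ => eq_comm
    rw [this, ← Set.image_univ, Function.Injective.encard_image fun s t h =>
      smul_left_injective F (he.ne_zero i)
        (add_left_cancel (affinePoint_injective hΘ (Sum.inl_injective h))), Set.encard_univ]
    exact ENat.card_eq_coe_natCard F

/-! ### Octagons distinguish points from lines -/

/-- Every path of length four with middle vertex `x` can be closed to an octagon. -/
def ClosesOctagons {X : Type*} (G : SimpleGraph X) (x : X) : Prop :=
  ∀ a b a' b', G.Adj x a → G.Adj x b → a ≠ b → G.Adj a a' → a' ≠ x → G.Adj b b' → b' ≠ x →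
    ∃ y c d, y ≠ x ∧ G.Adj a' c ∧ G.Adj c y ∧ G.Adj y d ∧ G.Adj d b'

lemma ClosesOctagons.map {X : Type*} {G : SimpleGraph X} {x : X} (h : ClosesOctagons G x)
    (α : G ≃g G) : ClosesOctagons G (α x) := by
  intro a b a' b' h1 h2 h3 h4 h5 h6 h7
  have key : ∀ u v, G.Adj (α u) v ↔ G.Adj u (α.symm v) := fun u v => by
    rw [← α.map_adj_iff (w := α.symm v), α.apply_symm_apply]
  have key' : ∀ u v, G.Adj u v ↔ G.Adj (α.symm u) (α.symm v) := fun u v =>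
    (α.symm.map_adj_iff).symm
  have hne : ∀ u, u ≠ α x → α.symm u ≠ x := fun u hu h => hu (by rw [← h, α.apply_symm_apply])
  obtain ⟨y, c, d, h8, h9, h10, h11, h12⟩ := h (α.symm a) (α.symm b) (α.symm a') (α.symm b')
    ((key _ _).mp h1) ((key _ _).mp h2) (fun h => h3 (α.symm.injective h)) ((key' _ _).mp h4)
    (hne _ h5) ((key' _ _).mp h6) (hne _ h7)
  refine ⟨α y, α c, α d, fun h => h8 (α.injective h), ((key _ _).mpr h9.symm).symm,
    α.map_adj_iff.mpr h10, α.map_adj_iff.mpr h11, (key _ _).mpr h12⟩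

/-- The fourth corner `w + s • e i + t • e j` of the parallelogram closes the path. It differs from
`w` because `e i` and `e j` are not proportional. -/
lemma IsRepresentation.closesOctagons_point (he : IsRepresentation K e)
    (hΘ : ∀ w, Θ (0, w) = (w : V)) (P : AffinePoint H) :
    ClosesOctagons (incidenceGraph H K) (.inl P) := by
  obtain ⟨w, rfl⟩ := affinePoint_surjective hΘ P
  intro a b a' b' h1 h2 h3 h4 h5 h6 h7
  obtain ⟨i, rfl⟩ := (adj_point_iff he hΘ w _).mp h1
  obtain ⟨j, rfl⟩ := (adj_point_iff he hΘ w _).mp h2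
  obtain ⟨s, rfl⟩ := (adj_line_iff he hΘ i w _).mp h4
  obtain ⟨t, rfl⟩ := (adj_line_iff he hΘ j w _).mp h6
  have hs : s ≠ 0 := by
    rintro rfl
    exact h5 (by simp)
  refine ⟨.inl (affinePoint hΘ (w + s • e i + t • e j)),
    .inr (directedLine he hΘ j (w + s • e i)), .inr (directedLine he hΘ i (w + t • e j)),
    fun h => ?_, adj_self he hΘ _ _, ((adj_iff he hΘ _ _ _).mpr ⟨t, rfl⟩).symm,
    (adj_iff he hΘ _ _ _).mpr ⟨s, add_right_comm _ _ _⟩, (adj_self he hΘ _ _).symm⟩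
  have h8 := affinePoint_injective hΘ (Sum.inl_injective h)
  have h9 : s • e i = (-t) • e j := by
    rw [add_assoc, add_eq_left] at h8
    rw [neg_smul]
    exact eq_neg_of_add_eq_zero_left h8
  exact h3 (by rw [(he.smul_eq_smul hs h9).1])

/-- On a line of direction `k`, take two points differing by `e k` and leave them in directions `i`
and `j`, with `i`, `j`, `k` distinct. A closing line of direction `m` would give a relation between
`e k`, `e j`, `e i` and `e m`. -/
lemma IsRepresentation.not_closesOctagons_line (he : IsRepresentation K e)
    (hΘ : ∀ w, Θ (0, w) = (w : V)) (hι : 3 ≤ Fintype.card ι) (L : RepLine H K) :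
    ¬ ClosesOctagons (incidenceGraph H K) (.inr L) := by
  obtain ⟨k, w, rfl⟩ := directedLine_surjective he hΘ L
  obtain ⟨i, hik⟩ : ∃ i, i ≠ k := by
    have : Nontrivial ι := Fintype.one_lt_card_iff_nontrivial.mp (by lia)
    exact exists_ne k
  obtain ⟨j, hj⟩ : ∃ j, j ∉ ({i, k} : Finset ι) := by
    by_contra! hall
    have h1 : (Finset.univ : Finset ι).card ≤ ({i, k} : Finset ι).card :=
      Finset.card_le_card fun m _ => hall m
    have := Finset.card_le_two (a := i) (b := k)
    rw [Finset.card_univ] at h1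
    lia
  simp only [Finset.mem_insert, Finset.mem_singleton, not_or] at hj
  intro h
  obtain ⟨y, c, d, hy, hac, hcy, hyd, hdb⟩ := h (.inl (affinePoint hΘ w))
    (.inl (affinePoint hΘ (w + (1 : F) • e k))) (.inr (directedLine he hΘ i w))
    (.inr (directedLine he hΘ j (w + (1 : F) • e k))) (adj_self he hΘ k w).symm
    ((adj_iff he hΘ _ _ _).mpr ⟨1, rfl⟩).symm
    (fun h => by
      have := affinePoint_injective hΘ (Sum.inl_injective h)
      simp [he.ne_zero k] at this)
    (adj_self he hΘ _ _) (fun h => hik (directedLine_injective he hΘ w (Sum.inr_injective h)))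
    (adj_self he hΘ _ _) (fun h => hj.2 (directedLine_injective he hΘ (w + (1 : F) • e k) (by
      simp only [directedLine_add_smul he hΘ k]
      exact Sum.inr_injective h)))
  obtain ⟨s, rfl⟩ := (adj_line_iff he hΘ _ _ _).mp hac
  obtain ⟨t, rfl⟩ := (adj_line_iff he hΘ _ _ _).mp hdb.symm
  obtain ⟨m, rfl⟩ := (adj_point_iff he hΘ _ _).mp hcy
  obtain ⟨u, hu⟩ := (adj_iff he hΘ _ _ _).mp hyd.symm
  -- The coefficient `1` of `e k` can only cancel if `m = k`. Then `s = 0`, and the closing line is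
  -- the original one.
  have hrel := he.relation k j i m 1 t (-s) (-u) (by
    have h1 : (1 : F) • e k + t • e j - s • e i - u • e m = 0 := by
      rw [sub_sub, sub_eq_zero, ← add_right_inj w, ← add_assoc, hu, add_assoc]
    rw [neg_smul, neg_smul, ← sub_eq_add_neg, ← sub_eq_add_neg, h1])
  have hk := congrFun hrel k
  have hi := congrFun hrel i
  have hkj : k ≠ j := fun h => hj.2 h.symm
  by_cases hmk : k = m
  · subst hmk
    have hs : s = 0 := by simpa [hik, Ne.symm hj.1, Pi.single_apply, eq_comm] using hi
    subst hs
    exact hy (by simp)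
  · simp [hmk, hkj, Ne.symm hik] at hk

end Coordinates

/-! ### The action on the incidence graph -/

section Action

open GammaL

variable {F V : Type*} [Field F] [AddCommGroup V] [Module F V]

lemma induction_span_smul {ι W : Type*} [Fintype ι] [AddCommGroup W] [Module F W] {e : ι → W}
    (he : Submodule.span F (Set.range e) = ⊤) {p : W → Prop} (h0 : p 0)
    (hadd : ∀ v w, p v → p w → p (v + w)) (hsmul : ∀ (c : F) i, p (c • e i)) (w : W) : p w := by
  have hw : w ∈ Submodule.span F (Set.range e) := by rw [he]; trivial
  obtain ⟨c, rfl⟩ := (Submodule.mem_span_range_iff_exists_fun F).mp hw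
  exact Finset.sum_induction _ p hadd h0 fun i _ => hsmul _ _

/-- The image of a projective subspace under a collineation. -/
def mapSubspace (g : PGammaL F V) (L : Projectivization.Subspace F V) :
    Projectivization.Subspace F V where
  carrier := {P | g⁻¹ • P ∈ L}
  mem_add' v w hv hw hvw h1 h2 := by
    obtain ⟨y, hy⟩ := toPGammaL_surjective g⁻¹
    simp only [Set.mem_ofPred_eq, ← hy, toPGammaL_smul_mk] at h1 h2 ⊢
    have h3 : y (v + w) = y v + y w := map_add y.f v w
    have h4 := L.mem_add _ _ (y.ne_zero hv) (y.ne_zero hw) (h3 ▸ y.ne_zero hvw) h1 h2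
    simpa only [h3] using h4

lemma mem_mapSubspace {g : PGammaL F V} {L : Projectivization.Subspace F V} {P : ℙ F V} :
    P ∈ mapSubspace g L ↔ g⁻¹ • P ∈ L := Iff.rfl

lemma coe_mapSubspace (g : PGammaL F V) (L : Projectivization.Subspace F V) :
    (mapSubspace g L : Set (ℙ F V)) = g • (L : Set (ℙ F V)) := by
  ext P
  rw [Set.mem_smul_set_iff_inv_smul_mem]
  rfl

/-- A lift of `g⁻¹` is only semilinear, so the ranks are compared through an additive bijection
compatible with its field automorphism. -/
lemma finrank_mapSubspace (g : PGammaL F V) (L : Projectivization.Subspace F V) :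
    Module.finrank F (Projectivization.Subspace.submodule (mapSubspace g L)) =
      Module.finrank F (Projectivization.Subspace.submodule L) := by
  obtain ⟨y, hy⟩ := toPGammaL_surjective g⁻¹
  have hmem : ∀ v, v ∈ Projectivization.Subspace.submodule (mapSubspace g L) ↔
      y v ∈ Projectivization.Subspace.submodule L := by
    intro v
    by_cases hv : v = 0
    · rw [hv, show y 0 = 0 from map_zero y.f]
      simp
    · rw [Projectivization.Subspace.mem_submodule_iff _ hv,
        Projectivization.Subspace.mem_submodule_iff _ (y.ne_zero hv), mem_mapSubspace, ← hy,
        toPGammaL_smul_mk]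
  let j : Projectivization.Subspace.submodule (mapSubspace g L) ≃+
      Projectivization.Subspace.submodule L :=
    { toFun := fun v => ⟨y v, (hmem v).mp v.2⟩
      invFun := fun v => ⟨y⁻¹ v, (hmem _).mpr (by rw [apply_inv_apply]; exact v.2)⟩
      left_inv := fun v => Subtype.ext (inv_apply_apply y v)
      right_inv := fun v => Subtype.ext (apply_inv_apply y v)
      map_add' := fun v w => Subtype.ext (map_add y.f _ _) }
  exact congrArg Cardinal.toNat
    (rank_eq_of_equiv_equiv y.σ j y.σ.bijective fun c v => Subtype.ext (y.apply_smul c v))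

variable {ι : Type*} {H : Submodule F V}
  [Fintype ι] [DecidableEq ι] {K : Set (ℙ F H)} {e : ι → H} {Θ : (F × H) ≃ₗ[F] V}

lemma IsRepresentation.smul_mem_projectivization [Finite H] (he : IsRepresentation K e)
    (hΘ : ∀ w, Θ (0, w) = (w : V)) (g : PGammaLStab (incl H '' K)) {P : ℙ F V}
    (hP : P ∈ H.projectivization) : g • P ∈ H.projectivization := by
  obtain ⟨t, x, hg, -⟩ := he.exists_affine hΘ g.2
  obtain ⟨Q, rfl⟩ := mem_projectivization_iff.mp hP
  refine mem_projectivization_iff.mpr ⟨toPGammaL x • Q, ?_⟩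
  rw [← affine_smul_incl hΘ t, ← hg]
  rfl

/-- The action of the collineation stabiliser of `K` on the incidence graph. -/
lemma IsRepresentation.exists_action [Finite H] (he : IsRepresentation K e)
    (hΘ : ∀ w, Θ (0, w) = (w : V)) :
    ∃ ρ : PGammaLStab (incl H '' K) →* (incidenceGraph H K ≃g incidenceGraph H K),
      (∀ (g : PGammaLStab (incl H '' K)) (P : AffinePoint H),
        ∃ P' : AffinePoint H, ρ g (Sum.inl P) = Sum.inl P' ∧ P'.1 = g • P.1) ∧
      (∀ (g : PGammaLStab (incl H '' K)) (L : RepLine H K),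
        ∃ L' : RepLine H K, ρ g (Sum.inr L) = Sum.inr L' ∧
          (L'.1 : Set (ℙ F V)) = g • (L.1 : Set (ℙ F V))) := by
  have hmem : ∀ (g : PGammaLStab (incl H '' K)) (P : ℙ F V),
      g • P ∈ H.projectivization ↔ P ∈ H.projectivization := fun g P =>
    ⟨fun h => by simpa using he.smul_mem_projectivization hΘ g⁻¹ h,
      he.smul_mem_projectivization hΘ g⟩
  let p : PGammaLStab (incl H '' K) → AffinePoint H → AffinePoint H := fun g P =>
    ⟨g • P.1, fun h => P.2 ((hmem g P.1).mp h)⟩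
  let l : PGammaLStab (incl H '' K) → RepLine H K → RepLine H K := fun g L =>
    ⟨mapSubspace g L.1, by
      refine ⟨(finrank_mapSubspace _ _).trans L.2.1, ?_, fun h => L.2.2.2 fun P hP => ?_⟩
      · obtain ⟨P, hP, hPL⟩ := L.2.2.1
        obtain ⟨Q, hQ, hQP⟩ := (MulAction.mem_stabilizer_iff.mp g.2).subset
          (Set.smul_mem_smul_set (Set.mem_image_of_mem (incl H) hP))
        refine ⟨Q, hQ, ?_⟩
        rw [hQP, mem_mapSubspace]
        simpa using hPL
      · refine (hmem g P).mp (h ?_)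
        rw [mem_mapSubspace]
        change (g : PGammaL F V)⁻¹ • (g : PGammaL F V) • P ∈ L.1
        rwa [inv_smul_smul]⟩
  have hp1 : ∀ P, p 1 P = P := fun P => Subtype.ext (one_smul _ _)
  have hpm : ∀ g h P, p (g * h) P = p g (p h P) := fun g h P => Subtype.ext (mul_smul _ _ _)
  have hl1 : ∀ L, l 1 L = L := fun L => Subtype.ext (SetLike.coe_injective (by
    simp [l, coe_mapSubspace]))
  have hlm : ∀ g h L, l (g * h) L = l g (l h L) := fun g h L =>
    Subtype.ext (SetLike.coe_injective (by
      simp only [l, coe_mapSubspace]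
      exact mul_smul _ _ _))
  have hpl : ∀ g (P : AffinePoint H) (L : RepLine H K),
      (p g P).1 ∈ (l g L).1 ↔ P.1 ∈ L.1 := fun g P L => by
    change (g : PGammaL F V)⁻¹ • (g : PGammaL F V) • P.1 ∈ L.1 ↔ _
    rw [inv_smul_smul]
  let ρ : PGammaLStab (incl H '' K) →* (incidenceGraph H K ≃g incidenceGraph H K) :=
    MonoidHom.mk' (fun g =>
      { toFun := Sum.map (p g) (l g)
        invFun := Sum.map (p g⁻¹) (l g⁻¹)
        left_inv := by
          rintro (P | L)
          · simp [← hpm, hp1]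
          · simp [← hlm, hl1]
        right_inv := by
          rintro (P | L)
          · simp [← hpm, hp1]
          · simp [← hlm, hl1]
        map_rel_iff' := by
          rintro (P | L) (P' | L')
          · exact Iff.rfl
          · exact hpl g P L'
          · exact hpl g P' L
          · exact Iff.rfl }) fun g h => by
      ext x
      rcases x with P | L
      · exact congrArg Sum.inl (hpm g h P)
      · exact congrArg Sum.inr (hlm g h L)
  exact ⟨ρ, fun g P => ⟨p g P, rfl, rfl⟩, fun g L => ⟨l g L, rfl, coe_mapSubspace _ _⟩⟩

/-! ### Semisymmetry and the full automorphism group -/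

section Consequences

variable {ρ : PGammaLStab (incl H '' K) →* (incidenceGraph H K ≃g incidenceGraph H K)}

lemma action_affinePoint (hΘ : ∀ w, Θ (0, w) = (w : V))
    (hρ : ∀ (g : PGammaLStab (incl H '' K)) (P : AffinePoint H),
        ∃ P' : AffinePoint H, ρ g (Sum.inl P) = Sum.inl P' ∧ P'.1 = g • P.1)
    {g : PGammaLStab (incl H '' K)} {t : H} {x : GammaL F H}
    (hg : (g : PGammaL F V) = toPGammaL (affine Θ t x)) (w : H) :
    ρ g (Sum.inl (affinePoint hΘ w)) = Sum.inl (affinePoint hΘ (t + x w)) := by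
  obtain ⟨P', h1, h2⟩ := hρ g (affinePoint hΘ w)
  rw [h1]
  congr 1
  apply Subtype.ext
  rw [h2, ← affine_smul_affinePoint, ← hg]
  rfl

/-- An element acts on the coordinate vectors by `w ↦ t + x w`. If this is the identity, `w = 0`
gives `t = 0`, and a nonzero vector then shows that `x.σ` is trivial. -/
lemma IsRepresentation.action_injective [Finite H] [Nontrivial H] (he : IsRepresentation K e)
    (hΘ : ∀ w, Θ (0, w) = (w : V))
    (hρ : ∀ (g : PGammaLStab (incl H '' K)) (P : AffinePoint H),
        ∃ P' : AffinePoint H, ρ g (Sum.inl P) = Sum.inl P' ∧ P'.1 = g • P.1) :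
    Function.Injective ρ := by
  rw [injective_iff_map_eq_one]
  intro g hg
  obtain ⟨t, x, hx, -⟩ := he.exists_affine hΘ g.2
  have h1 : ∀ w, t + x w = w := fun w => by
    have := action_affinePoint hΘ hρ hx w
    rw [hg] at this
    exact (affinePoint_injective hΘ (Sum.inl_injective this)).symm
  have ht : t = 0 := by
    have := h1 0
    rwa [show x 0 = 0 from map_zero x.f, add_zero] at this
  subst ht
  simp only [zero_add] at h1
  obtain ⟨w, hw⟩ := exists_ne (0 : H)
  have hx1 : x = 1 := by
    refine GammaL.ext' (RingEquiv.ext fun c => ?_) h1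
    have := x.apply_smul c w
    rw [h1, h1] at this
    exact (smul_left_injective F hw this).symm
  subst hx1
  refine Subtype.ext ?_
  rw [hx]
  exact ((toPGammaL (F := F) (W := V)).comp (extend Θ)).map_one

/-- A linear map swapping `e i` and `e j` adjusts the direction, and a translation then adjusts the
point. -/
lemma IsRepresentation.exists_action_edge [Finite H] (he : IsRepresentation K e)
    (hΘ : ∀ w, Θ (0, w) = (w : V))
    (hρ : ∀ (g : PGammaLStab (incl H '' K)) (P : AffinePoint H),
        ∃ P' : AffinePoint H, ρ g (Sum.inl P) = Sum.inl P' ∧ P'.1 = g • P.1)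
    (hρ' : ∀ (g : PGammaLStab (incl H '' K)) (L : RepLine H K),
        ∃ L' : RepLine H K, ρ g (Sum.inr L) = Sum.inr L' ∧
          (L'.1 : Set (ℙ F V)) = g • (L.1 : Set (ℙ F V))) (v w : H) (i j : ι) :
    ∃ g, ρ g (Sum.inl (affinePoint hΘ v)) = Sum.inl (affinePoint hΘ w) ∧
      ρ g (Sum.inr (directedLine he hΘ i v)) = Sum.inr (directedLine he hΘ j w) := by
  obtain ⟨x, -, hx⟩ := he.permute 1 (Equiv.swap i j)
  have hst : toPGammaL (affine Θ (w - x v) x) ∈ PGammaLStab (incl H '' K) :=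
    (affine_mem_stabilizer_iff hΘ K _ x).mpr
      ((he.mem_stabilizer_iff x).mpr ⟨1, Equiv.swap i j, fun i => by simp [hx]⟩)
  have h1 : ρ ⟨_, hst⟩ (Sum.inl (affinePoint hΘ v)) = Sum.inl (affinePoint hΘ w) := by
    rw [action_affinePoint hΘ hρ rfl, sub_add_cancel]
  refine ⟨⟨_, hst⟩, h1, ?_⟩
  obtain ⟨L', hL, hL'⟩ := hρ' ⟨_, hst⟩ (directedLine he hΘ i v)
  rw [hL]
  congr 1
  refine eq_directedLine he hΘ ?_ ?_
  · have := (ρ ⟨_, hst⟩).map_adj_iff.mpr (adj_self he hΘ i v)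
    rw [h1, hL] at this
    exact this
  · change _ ∈ (L'.1 : Set (ℙ F V))
    rw [hL']
    refine ⟨incl H (Projectivization.mk F (e i) (he.ne_zero i)),
      Submodule.subset_span ⟨1, rfl⟩, ?_⟩
    change toPGammaL (affine Θ (w - x v) x) • incl H _ = _
    rw [affine_smul_incl hΘ, toPGammaL_smul_mk]
    simp [hx]

lemma IsRepresentation.isSemisymmetric [Finite F] [Finite H] (he : IsRepresentation K e)
    (hΘ : ∀ w, Θ (0, w) = (w : V)) (hι : Fintype.card ι = Nat.card F)
    (hι3 : 3 ≤ Fintype.card ι)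
    (hρ : ∀ (g : PGammaLStab (incl H '' K)) (P : AffinePoint H),
        ∃ P' : AffinePoint H, ρ g (Sum.inl P) = Sum.inl P' ∧ P'.1 = g • P.1)
    (hρ' : ∀ (g : PGammaLStab (incl H '' K)) (L : RepLine H K),
        ∃ L' : RepLine H K, ρ g (Sum.inr L) = Sum.inr L' ∧
          (L'.1 : Set (ℙ F V)) = g • (L.1 : Set (ℙ F V))) :
    IsSemisymmetric (incidenceGraph H K) := by
  have hedge : ∀ a ∈ (incidenceGraph H K).edgeSet, ∃ (w : H) (i : ι),
      a = s(.inl (affinePoint hΘ w), .inr (directedLine he hΘ i w)) := by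
    intro a
    induction a using Sym2.ind with | _ x y =>
    intro h
    rw [SimpleGraph.mem_edgeSet] at h
    rcases x with P | L
    · obtain ⟨w, rfl⟩ := affinePoint_surjective hΘ P
      obtain ⟨i, rfl⟩ := (adj_point_iff he hΘ w y).mp h
      exact ⟨w, i, rfl⟩
    · rcases y with P | L'
      · obtain ⟨w, rfl⟩ := affinePoint_surjective hΘ P
        obtain ⟨i, hi⟩ := (adj_point_iff he hΘ w _).mp h.symm
        exact ⟨w, i, by rw [hi, Sym2.eq_swap]⟩
      · exact h.elim
  refine ⟨⟨Nat.card F, he.regular hΘ hι⟩, fun a ha b hb => ?_, fun h => ?_⟩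
  · obtain ⟨v, i, rfl⟩ := hedge a ha
    obtain ⟨w, j, rfl⟩ := hedge b hb
    obtain ⟨g, hg, hg'⟩ := he.exists_action_edge hΘ hρ hρ' v w i j
    exact ⟨ρ g, by rw [Sym2.map_mk, hg, hg']⟩
  · have : Nonempty ι := Fintype.card_pos_iff.mp (by lia)
    obtain ⟨i⟩ := this
    obtain ⟨α, hα⟩ := h (.inl (affinePoint hΘ 0)) (.inr (directedLine he hΘ i 0))
    have := (he.closesOctagons_point hΘ (affinePoint hΘ 0)).map α
    rw [hα] at this
    exact he.not_closesOctagons_line hΘ hι3 _ this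

/-- An automorphism of the incidence graph acts on the affine points as an affine map, if the
points of `K` other than any given one span the hyperplane. -/
lemma IsRepresentation.exists_additive (he : IsRepresentation K e)
    (hΘ : ∀ w, Θ (0, w) = (w : V)) (hι3 : 3 ≤ Fintype.card ι)
    (hspan : ∀ j, Submodule.span F (Set.range fun i : {i // i ≠ j} => e i.1) = ⊤)
    (α : incidenceGraph H K ≃g incidenceGraph H K) :
    ∃ (t : H) (B : H →+ H) (c : ι → Fˣ) (π : ι → ι),
      (∀ w, α (.inl (affinePoint hΘ w)) = .inl (affinePoint hΘ (t + B w))) ∧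
      Function.Injective B ∧ Function.Injective π ∧ ∀ i, B (e i) = (c i : F) • e (π i) := by
  -- The octagon property is invariant under automorphisms, so points go to points. Below, `d i w`
  -- is the direction of the image of the line through `w` in direction `i`.
  have hA : ∀ w, ∃ v, α (.inl (affinePoint hΘ w)) = .inl (affinePoint hΘ v) := by
    intro w
    have h1 := (he.closesOctagons_point hΘ (affinePoint hΘ w)).map α
    rcases hα : α (.inl (affinePoint hΘ w)) with P | L
    · obtain ⟨v, rfl⟩ := affinePoint_surjective hΘ P
      exact ⟨v, rfl⟩
    · rw [hα] at h1
      exact (he.not_closesOctagons_line hΘ hι3 L h1).elim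
  choose A hA using hA
  have hd : ∀ i w, ∃ j, α (.inr (directedLine he hΘ i w)) = .inr (directedLine he hΘ j (A w)) := by
    intro i w
    have := α.map_adj_iff.mpr (adj_self he hΘ i w)
    rw [hA] at this
    exact (adj_point_iff he hΘ _ _).mp this
  choose d hd using hd
  have hAinj : Function.Injective A := fun v w h => affinePoint_injective hΘ
    (Sum.inl_injective (α.injective (by rw [hA, hA, h])))
  have hdinj : ∀ w, Function.Injective fun i => d i w := fun w i j h =>
    directedLine_injective he hΘ w (Sum.inr_injective (α.injective (by
      rw [hd, hd, show d i w = d j w from h])))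
  have hstep : ∀ i w (t : F), ∃ c : F, A (w + t • e i) = A w + c • e (d i w) := by
    intro i w t
    have := α.map_adj_iff.mpr ((adj_iff he hΘ i (w + t • e i) w).mpr ⟨t, rfl⟩)
    rw [hA, hd] at this
    exact (adj_iff he hΘ _ _ _).mp this
  -- Points of one line in direction `i` share that line, and hence the direction of its image.
  have hdstep : ∀ i w (t : F), d i (w + t • e i) = d i w := by
    intro i w t
    have h1 := hd i (w + t • e i)
    rw [directedLine_add_smul, hd] at h1
    obtain ⟨c, hc⟩ := hstep i w t
    have h2 := Sum.inr_injective h1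
    rw [← directedLine_add_smul he hΘ (d i w) (A w) c, ← hc] at h2
    exact (directedLine_injective he hΘ _ h2).symm
  -- The image of a parallelogram is a closed quadrangle, hence a four-term relation. The direction
  -- `d i w` of its first side differs from those of both sides coming from `e j`, so that term can
  -- only cancel against the opposite side.
  have hquad : ∀ i j, j ≠ i → ∀ w (s t : F),
      A (w + s • e j + t • e i) - A (w + s • e j) = A (w + t • e i) - A w := by
    intro i j hji w s t
    obtain ⟨x, hx⟩ := hstep i w t
    obtain ⟨y, hy⟩ := hstep j (w + t • e i) s
    obtain ⟨z, hz⟩ := hstep i (w + s • e j) t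
    obtain ⟨u, hu⟩ := hstep j w s
    by_cases ht : t = 0
    · simp [ht]
    have hx0 : x ≠ 0 := by
      rintro rfl
      rw [zero_smul, add_zero] at hx
      have := hAinj hx
      rw [add_eq_left] at this
      exact (smul_ne_zero ht (he.ne_zero i)) this
    have hab : d j (w + t • e i) ≠ d i w := by
      rw [← hdstep i w t]
      exact fun h => hji (hdinj _ h)
    have had : d j w ≠ d i w := fun h => hji (hdinj _ h)
    have hrel : x • e (d i w) + y • e (d j (w + t • e i)) + (-z) • e (d i (w + s • e j)) +
        (-u) • e (d j w) = 0 := by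
      have h1 : A (w + t • e i + s • e j) = A (w + s • e j + t • e i) := by
        rw [add_right_comm]
      rw [hy, hz, hx, hu] at h1
      rw [neg_smul, neg_smul, ← sub_eq_add_neg, ← sub_eq_add_neg, sub_sub, sub_eq_zero,
        ← add_right_inj (A w), ← add_assoc, h1, add_assoc, add_comm (u • _)]
    have hrel' := congrFun (he.relation _ _ _ _ _ _ _ _ hrel) (d i w)
    by_cases hac : d i w = d i (w + s • e j)
    · have : x = z := by
        simpa [hab.symm, had.symm, ← hac, ← sub_eq_add_neg, sub_eq_zero] using hrel'
      rw [hz, hx, add_sub_cancel_left, add_sub_cancel_left, ← hac, this]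
    · simp [hab.symm, had.symm, hac, hx0] at hrel'
  -- The increment along `e i` is invariant under moves along every `e j` with `j ≠ i`. By `hspan`
  -- these moves reach all of `H`; this fails for a basis.
  have hconst : ∀ i (t : F) v w, A (w + v + t • e i) - A (w + v) = A (w + t • e i) - A w := by
    intro i t v
    refine induction_span_smul (hspan i) (p := fun v => ∀ w, A (w + v + t • e i) - A (w + v) =
      A (w + t • e i) - A w) (by simp) (fun v v' h h' w => ?_) (fun c j w => hquad i j j.2 w c t) v
    rw [← add_assoc, h', h]
  have hadd : ∀ v w, A (w + v) = A w + (A v - A 0) := by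
    refine induction_span_smul he.span_eq (by simp) (fun v v' h h' w => ?_) fun c i w => ?_
    · rw [← add_assoc, h', h, h' v]
      abel
    · have := hconst i c w 0
      rw [zero_add, zero_add] at this
      rw [← this]
      abel
  refine ⟨A 0, AddMonoidHom.mk' (fun w => A w - A 0) fun v w => ?_, ?_⟩
  · rw [hadd w v]
    abel
  have hB : ∀ i, ∃ c : Fˣ, A (e i) - A 0 = (c : F) • e (d i 0) := by
    intro i
    obtain ⟨c, hc⟩ := hstep i 0 1
    rw [one_smul, zero_add] at hc
    have hc0 : c ≠ 0 := by
      rintro rfl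
      rw [zero_smul, add_zero] at hc
      exact he.ne_zero i (hAinj hc)
    exact ⟨Units.mk0 c hc0, by rw [hc, add_sub_cancel_left]; rfl⟩
  choose c hc using hB
  refine ⟨c, fun i => d i 0, fun w => ?_, fun v w h => ?_, hdinj 0, hc⟩
  · rw [hA]
    simp
  · exact hAinj (sub_left_injective h)

/-- Over a prime field every scalar is an integer multiple of `1`. -/
lemma map_smul_of_prime_card [Finite F] (hp : (Nat.card F).Prime) {W : Type*} [AddCommGroup W]
    [Module F W] (B : W →+ W) (c : F) (w : W) : B (c • w) = c • B w := by
  have : Fact (Nat.card F).Prime := ⟨hp⟩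
  obtain ⟨k, rfl⟩ := AddSubgroup.mem_zmultiples_iff.mp
    (mem_zmultiples_of_prime_card (G := F) (p := Nat.card F) rfl (g := 1) (g' := c) one_ne_zero)
  simp only [smul_assoc, one_smul]
  exact map_zsmul B k w

lemma IsRepresentation.action_surjective [Finite F] [Finite H] (he : IsRepresentation K e)
    (hΘ : ∀ w, Θ (0, w) = (w : V)) (hι3 : 3 ≤ Fintype.card ι)
    (hspan : ∀ j, Submodule.span F (Set.range fun i : {i // i ≠ j} => e i.1) = ⊤)
    (hp : (Nat.card F).Prime)
    (hρ : ∀ (g : PGammaLStab (incl H '' K)) (P : AffinePoint H),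
        ∃ P' : AffinePoint H, ρ g (Sum.inl P) = Sum.inl P' ∧ P'.1 = g • P.1) :
    Function.Surjective ρ := by
  intro α
  obtain ⟨t, B, c, π, hα, hB, hπ, hc⟩ := he.exists_additive hΘ hι3 hspan α
  let x : GammaL F H :=
    ⟨1, AddEquiv.ofBijective B (Finite.injective_iff_bijective.mp hB),
      map_smul_of_prime_card hp B⟩
  have hst : toPGammaL (affine Θ t x) ∈ PGammaLStab (incl H '' K) :=
    (affine_mem_stabilizer_iff hΘ K t x).mpr ((he.mem_stabilizer_iff x).mpr
      ⟨c, Equiv.ofBijective π (Finite.injective_iff_bijective.mp hπ), hc⟩)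
  have hpt : ∀ w, ρ ⟨_, hst⟩ (.inl (affinePoint hΘ w)) = α (.inl (affinePoint hΘ w)) := fun w => by
    rw [action_affinePoint hΘ hρ rfl, hα]
    rfl
  refine ⟨⟨_, hst⟩, ?_⟩
  ext y
  rcases y with P | L
  · obtain ⟨w, rfl⟩ := affinePoint_surjective hΘ P
    exact hpt w
  · obtain ⟨i, w, rfl⟩ := directedLine_surjective he hΘ L
    -- An automorphism is determined by its action on the points: the image of a line passes through
    -- the images of its points `w` and `w + e i`, which fix its direction.
    have h1 : ∀ β : incidenceGraph H K ≃g incidenceGraph H K,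
        (∀ w, β (.inl (affinePoint hΘ w)) = α (.inl (affinePoint hΘ w))) →
        ∃ j, β (.inr (directedLine he hΘ i w)) = .inr (directedLine he hΘ j (t + B w)) ∧
          ∃ s : F, B (e i) = s • e j := by
      intro β hβ
      have h2 := β.map_adj_iff.mpr (adj_self he hΘ i w)
      rw [hβ, hα] at h2
      obtain ⟨j, hj⟩ := (adj_point_iff he hΘ _ _).mp h2
      have h3 := β.map_adj_iff.mpr ((adj_iff he hΘ i (w + (1 : F) • e i) w).mpr ⟨1, rfl⟩)
      rw [hβ, hα, hj, adj_iff] at h3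
      obtain ⟨s, hs⟩ := h3
      refine ⟨j, hj, s, ?_⟩
      rwa [one_smul, map_add, ← add_assoc, add_right_inj] at hs
    obtain ⟨j, hj, s, hs⟩ := h1 (ρ ⟨_, hst⟩) hpt
    obtain ⟨k, hk, u, hu⟩ := h1 α fun _ => rfl
    rw [hc] at hs hu
    rw [hj, hk, ← (he.smul_eq_smul (c i).ne_zero hs).1, (he.smul_eq_smul (c i).ne_zero hu).1]

end Consequences

end Action

end LinearRepresentation

open LinearRepresentation
theorem mainTheorem3 {F V : Type*} [Field F] [Finite F] [AddCommGroup V] [Module F V]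
    (p h n q : ℕ) (hp : p.Prime) (hq : q = p ^ h) (hF : Nat.card F = q)
    (hV : Module.finrank F V = n + 2)
    (H : Submodule F V) (hH : Module.finrank F H = n + 1)
    (hn : 2 ≤ n) (hqn : q = n + 1 ∨ q = n + 2) (hexc : (n, q) ≠ (2, 4))
    (K : Set (ℙ F H)) (hK : IsArc n q K) :
    IsSemisymmetric (incidenceGraph H K) ∧
    -- the stabiliser of `K` acts faithfully on the graph, and it induces the full automorphism
    -- group if `q = n + 2` is prime
    (∃ ρ : PGammaLStab (incl H '' K) →* (incidenceGraph H K ≃g incidenceGraph H K),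
      (∀ (g : PGammaLStab (incl H '' K)) (P : AffinePoint H),
        ∃ P' : AffinePoint H, ρ g (Sum.inl P) = Sum.inl P' ∧ P'.1 = g • P.1) ∧
      (∀ (g : PGammaLStab (incl H '' K)) (L : RepLine H K),
        ∃ L' : RepLine H K, ρ g (Sum.inr L) = Sum.inr L' ∧
          (L'.1 : Set (ℙ F V)) = g • (L.1 : Set (ℙ F V))) ∧
      Function.Injective ρ ∧
      (q = n + 2 → q.Prime → Function.Bijective ρ)) ∧
    -- the stabiliser of `K` is the split extension of `Persp(H)` by the stabiliser in `PΓL(n+1,q)`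
    (∃ (φ : PGammaLStab K →* MulAut (Persp H))
      (e : Persp H ⋊[φ] PGammaLStab K ≃* PGammaLStab (incl H '' K)),
      (∀ x : Persp H, ((e (SemidirectProduct.inl x) : PGammaLStab (incl H '' K)) :
        PGammaL F V) = x) ∧
      ∀ (g : PGammaLStab K) (P : ℙ F H),
        e (SemidirectProduct.inr g) • incl H P = incl H (g • P)) ∧
    -- here `Aut(F)` acts trivially on `Sym(q)`: the automorphisms fix the entries of permutation
    -- matrices
    (q = n + 2 →
      Nonempty (PGammaLStab K ≃*
        Equiv.Perm (Fin q) ⋊[(1 : RingAut F →* MulAut (Equiv.Perm (Fin q)))] RingAut F) ∧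
      Nat.card (PGammaLStab (incl H '' K)) = h * q ^ (n + 1) * (q - 1) * q.factorial) ∧
    (q = n + 1 →
      Nonempty (PGammaLStab K ≃* PMon (Fin q) F ⋊[fieldAction (Fin q) F] RingAut F) ∧
      Nat.card (PGammaLStab (incl H '' K)) =
        h * q ^ (n + 1) * (q - 1) ^ (n + 1) * q.factorial) := by
  have : Module.Finite F V := Module.finite_of_finrank_pos (by lia)
  have : Finite H := Module.finite_of_finite F
  have : Nontrivial H := Module.nontrivial_of_finrank_pos (R := F) (by lia)
  obtain ⟨Θ, hΘ⟩ := exists_splitting (H := H) (by lia)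
  have hH2 : 2 ≤ Module.finrank F H := by lia
  have hq3 : 3 ≤ q := by lia
  have hι : Fintype.card (Fin q) = Nat.card F := by rw [Fintype.card_fin, hF]
  have hι3 : 3 ≤ Fintype.card (Fin q) := by rwa [Fintype.card_fin]
  have hAut : Nat.card (RingAut F) = h := card_ringAut hp (hF.trans hq)
  -- For `n = 2` this would be the excluded pair `(2, 4)`.
  have hq4 : q = n + 2 → 4 < q := fun hq2 => by
    have : n ≠ 2 := by
      rintro rfl
      exact hexc (by rw [hq2])
    lia
  obtain ⟨e, he⟩ : ∃ e : Fin q → H, IsRepresentation K e := by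
    rcases hqn with hq1 | hq2
    · obtain ⟨b, hb⟩ := hK.exists_basis hH hq1
      exact ⟨b, hb⟩
    · obtain ⟨e, he, -⟩ := hK.exists_frame hH hq2 (hq4 hq2)
      exact ⟨e, he⟩
  obtain ⟨ρ, hρ, hρ'⟩ := he.exists_action hΘ
  have hinj := he.action_injective hΘ hρ
  obtain ⟨s, hs⟩ := he.exists_section hH2 hι
  have hsplit := he.exists_semidirectProduct hΘ s hs
  have hcard : Nat.card (PGammaLStab (incl H '' K)) =
      q ^ (n + 1) * (q - 1) * Nat.card (PGammaLStab K) := by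
    obtain ⟨φ, E, -⟩ := hsplit
    rw [← Nat.card_congr E.toEquiv, SemidirectProduct.card, card_persp hΘ hH2 (by lia),
      Nat.card_units, Module.natCard_eq_pow_finrank (K := F), hF, hH]
  refine ⟨he.isSemisymmetric hΘ hι hι3 hρ hρ', ⟨ρ, hρ, hρ', hinj, fun hq2 hqp => ⟨hinj, ?_⟩⟩,
    hsplit, fun hq2 => ?_, fun hq1 => ?_⟩
  · obtain ⟨e', he', -, -, hspan⟩ := hK.exists_frame hH hq2 (hq4 hq2)
    exact he'.action_surjective hΘ hι3 hspan (hF ▸ hqp) hρ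
  · obtain ⟨e', he', hsum, hrel, -⟩ := hK.exists_frame hH hq2 (hq4 hq2)
    obtain ⟨E⟩ := he'.nonempty_mulEquiv_frame hH2 hsum hrel
    refine ⟨⟨E⟩, ?_⟩
    rw [hcard, Nat.card_congr E.toEquiv, SemidirectProduct.card, hAut, Nat.card_perm,
      Nat.card_fin]
    ring
  · obtain ⟨b, hb⟩ := hK.exists_basis hH hq1
    refine ⟨hb.nonempty_mulEquiv_basis hH2, ?_⟩
    subst hq1
    rw [hcard, hb.card_stabilizer_basis hH2, hAut, Nat.card_units, hF]
    ring
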